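/- Let $q<p$ be non-negative integers and let $a(z)=z^p+a_1z^{p-1}+\cdots+a_p$ and $b(z)=b_0+b_1z+\cdots+b_{q-1}z^{q-1}+z^q$ be real polynomials without common zeroes, such that all zeroes $\lambda_1,\dots,\lambda_p$ of $a$ (listed with multiplicity) have negative real part. Let $L=(L_t)_{t\in\mathbb R}$ be a two-sided, second-order, zero-mean Lévy process with $E L_1^2=\sigma^2$, $\sigma>0$, and let $Y=(Y_t)_{t\in\mathbb R}$ be a CARMA$(p,q)$ process driven by $L$, i.e. a strictly stationary process with $Y_t=\mathbf b^{\top}\mathbf X_t$, where $\mathbf b=(b_0,\dots,b_{p-1})^\top$ with $b_q=1$ and $b_j=0$ for $q<j<p$, and where $\mathbf X$ is an $\mathbb R^p$-valued solution on $\mathbb R$ of $d\mathbf X_t=A\mathbf X_t\,dt+\mathbf e_p\,dL_t$. Here $\mathbf e_p$ is the last unit vector and $A$ is the companion matrix of $a$, with ones on the superdiagonal, last row $(-a_p,\dots,-a_1)$, and zeroes elsewhere. For $\Delta>0$ let $B$ denote the backward shift on sequences and put $$X^{\Delta}_n=\prod_{j=1}^p\bigl(1-e^{\lambda_j\Delta}B\bigr)Y_{n\Delta},\qquad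 n\in\mathbb Z,$$ which is the moving average part of the ARMA representation of the sampled sequence $(Y_{n\Delta})_{n\in\mathbb Z}$. Then for every $\Delta>0$ the sequence $(X^\Delta_n)_{n\in\mathbb Z}$ is weakly stationary with absolutely summable autocovariances $\gamma_{MA}(h)$, and it has the spectral density $$f_{MA}(\omega)=\frac1{2\pi}\sum_{h\in\mathbb Z}\gamma_{MA}(h)e^{-ih\omega},\qquad -\pi\le\omega\le\pi .$$ Moreover, for every fixed $\omega\in[-\pi,\pi]$, where $\omega\neq0$ is assumed if $q\ge1$, the following holds as $\Delta\downarrow0$, where $f\sim g$ means $f(\Delta)/g(\Delta)\to1$. If $p-q=1$, then $$f_{MA}(\omega)\sim\frac{\sigma^2\Delta}{2\pi}\,2^q(1-\cos\omega)^q .$$ If $p-q=2$, then $$f_{MA}(\omega)\sim\frac{\sigma^2\Delta^3}{2\pi}\Bigl(\frac23+\frac{\cos\omega}3\Bigr)2^q(1-\cos\omega)^q .$$ If $p-q=3$, then $$f_{MA}(\omega)\sim\frac{\sigma^2\Delta^5}{2\pi}\Bigl(\frac{11}{20}+\frac{13\cos\omega}{30}+\frac{\cos2\omega}{60}\Bigr)2^q(1-\cos\omega)^q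 .$$ (For $q=0$ the factor $2^q(1-\cos\omega)^q$ is $1$.) -/

import Mathlib

open MeasureTheory ProbabilityTheory Filter Topology

noncomputable section

namespace CARMA

/-! ### The driving process -/

/-- `L = (L_t)_{t ∈ ℝ}` is a (two-sided, real-valued) Lévy process: it starts at `0`, has
independent and stationary increments, and its paths are almost surely right continuous with
left limits. -/
structure IsLevyProcess {Ω : Type*} [MeasurableSpace Ω] (μ : Measure Ω) (L : ℝ → Ω → ℝ) :
    Prop where
  measurable : ∀ t, Measurable (L t)
  zero : ∀ᵐ x ∂μ, L 0 x = 0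
  indep_increments : HasIndepIncrements L μ
  stationary_increments : ∀ s t h : ℝ,
    IdentDistrib (fun x => L (t + h) x - L (s + h) x) (fun x => L t x - L s x) μ μ
  cadlag : ∀ᵐ x ∂μ, ∀ t : ℝ,
    ContinuousWithinAt (fun u => L u x) (Set.Ici t) t ∧
      ∃ l : ℝ, Tendsto (fun u => L u x) (𝓝[<] t) (𝓝 l)

/-- A second-order zero-mean Lévy process `L` with `E L_1 ^ 2 = σ ^ 2`. -/
structure IsSecondOrderLevy {Ω : Type*} [MeasurableSpace Ω] (μ : Measure Ω) (L : ℝ → Ω → ℝ)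
    (σ : ℝ) : Prop extends IsLevyProcess μ L where
  memLp : ∀ t, MemLp (L t) 2 μ
  mean_zero : ∀ t, ∫ x, L t x ∂μ = 0
  variance_one : ∫ x, (L 1 x) ^ 2 ∂μ = σ ^ 2

/-! ### CARMA processes -/

/-- Admissible autoregressive and moving average polynomials of orders `q < p`:
`a(z) = z ^ p + a_1 z ^ (p - 1) + ⋯ + a_p` and `b(z) = b_0 + b_1 z + ⋯ + b_{q-1} z ^ (q - 1) + z ^ q`
with real coefficients, without common (complex) zeroes, the zeroes of `a` all lying in the open
left half plane. -/
structure IsAdmissible (p q : ℕ) (a b : Polynomial ℝ) : Prop where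
  lt : q < p
  a_monic : a.Monic
  a_degree : a.natDegree = p
  b_monic : b.Monic
  b_degree : b.natDegree = q
  no_common_zero : ∀ z : ℂ, Polynomial.aeval z a = 0 → Polynomial.aeval z b ≠ 0
  zeros_left : ∀ z : ℂ, Polynomial.aeval z a = 0 → z.re < 0

/-- The `p × p` companion matrix of the state equation: ones on the superdiagonal and last row
`-a_p, -a_{p-1}, …, -a_1`, where `a_{p-j}` is the coefficient of `z ^ j` in `a`. -/
def stateMatrix (p : ℕ) (a : Polynomial ℝ) : Matrix (Fin p) (Fin p) ℝ :=
  Matrix.of fun i j =>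
    if (i : ℕ) + 1 = p then -a.coeff (j : ℕ)
    else if (j : ℕ) = (i : ℕ) + 1 then 1 else 0

/-- The last unit vector `e_p` of `ℝ ^ p`. -/
def lastUnit (p : ℕ) : Fin p → ℝ := fun i => if (i : ℕ) + 1 = p then 1 else 0

/-- The real process `Y` is strictly stationary: its finite-dimensional distributions are
invariant under time shifts. -/
def IsStrictlyStationary {Ω : Type*} [MeasurableSpace Ω] (μ : Measure Ω) (Y : ℝ → Ω → ℝ) :
    Prop :=
  ∀ (n : ℕ) (t : Fin n → ℝ) (h : ℝ),
    IdentDistrib (fun x i => Y (t i + h) x) (fun x i => Y (t i) x) μ μ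

/-- `X` solves the state equation `dX_t = A X_t dt + e_p dL_t` on `ℝ`. The noise is additive, so
the equation is read pathwise, in integrated form:
`X_t - X_s = ∫_s^t A X_u du + e_p (L_t - L_s)` for all `s ≤ t`. -/
structure SolvesStateEquation {Ω : Type*} [MeasurableSpace Ω] (μ : Measure Ω) (p : ℕ)
    (a : Polynomial ℝ) (L : ℝ → Ω → ℝ) (X : ℝ → Ω → Fin p → ℝ) : Prop where
  measurable : ∀ t, Measurable (X t)
  integrable : ∀ᵐ x ∂μ, ∀ s t : ℝ, IntervalIntegrable (fun u => X u x) volume s t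
  equation : ∀ᵐ x ∂μ, ∀ s t : ℝ, s ≤ t →
    X t x - X s x =
      (∫ u in s..t, (stateMatrix p a).mulVec (X u x)) + (L t x - L s x) • lastUnit p

/-- `Y` is a CARMA process with polynomials `a` (of degree `p`) and `b` driven by `L`: a strictly
stationary process satisfying the observation equation `Y_t = b_0 X_t^0 + ⋯ + b_{p-1} X_t^{p-1}`
for a solution `X` of the state equation. -/
structure IsCARMA {Ω : Type*} [MeasurableSpace Ω] (μ : Measure Ω) (p : ℕ)
    (a b : Polynomial ℝ) (L Y : ℝ → Ω → ℝ) : Prop where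
  measurable : ∀ t, Measurable (Y t)
  stationary : IsStrictlyStationary μ Y
  solution : ∃ X : ℝ → Ω → Fin p → ℝ, SolvesStateEquation μ p a L X ∧
    ∀ t, ∀ᵐ x ∂μ, Y t x = ∑ j : Fin p, b.coeff (j : ℕ) * X t x j

/-! ### Second-order theory of sequences -/

/-- Covariance `E (U - E U) (V - E V)^*` of two complex random variables. -/
def covar {Ω : Type*} [MeasurableSpace Ω] (μ : Measure Ω) (U V : Ω → ℂ) : ℂ :=
  ∫ x, (U x - ∫ y, U y ∂μ) * (starRingEnd ℂ) (V x - ∫ y, V y ∂μ) ∂μ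

/-- The sequence `(U_n)_{n ∈ ℤ}` is weakly stationary. -/
structure IsWeaklyStationary {Ω : Type*} [MeasurableSpace Ω] (μ : Measure Ω) (U : ℤ → Ω → ℂ) :
    Prop where
  memLp : ∀ n, MemLp (U n) 2 μ
  mean : ∀ n, ∫ x, U n x ∂μ = ∫ x, U 0 x ∂μ
  covar : ∀ n h, covar μ (U (n + h)) (U n) = covar μ (U h) (U 0)

/-- Autocovariance `γ(h) = Cov(U_h, U_0)` at lag `h`. -/
def autocov {Ω : Type*} [MeasurableSpace Ω] (μ : Measure Ω) (U : ℤ → Ω → ℂ) (h : ℤ) : ℂ :=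
  covar μ (U h) (U 0)

/-- `f` is a spectral density of the weakly stationary sequence `U`: it is nonnegative and
integrable on `[-π, π]` and `γ(h) = ∫_{-π}^{π} e^{i h w} f(w) dw` for all lags `h`. -/
structure IsSpectralDensity {Ω : Type*} [MeasurableSpace Ω] (μ : Measure Ω) (U : ℤ → Ω → ℂ)
    (f : ℝ → ℝ) : Prop where
  stationary : IsWeaklyStationary μ U
  nonneg : ∀ w ∈ Set.Icc (-Real.pi) Real.pi, 0 ≤ f w
  integrable : IntervalIntegrable f volume (-Real.pi) Real.pi
  autocov_eq : ∀ h : ℤ, autocov μ U h =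
    ∫ w in (-Real.pi)..Real.pi, Complex.exp (Complex.I * (h : ℂ) * (w : ℂ)) * (f w : ℂ)

/-- The spectral density `f(w) = (2π)⁻¹ ∑_{h ∈ ℤ} γ(h) e^{-i h w}` of a weakly stationary sequence
with absolutely summable autocovariances (the sum is then real). -/
def spectralDensity {Ω : Type*} [MeasurableSpace Ω] (μ : Measure Ω) (U : ℤ → Ω → ℂ) (w : ℝ) :
    ℝ :=
  1 / (2 * Real.pi) *
    (∑' h : ℤ, autocov μ U h * Complex.exp (-(Complex.I * (h : ℂ) * (w : ℂ)))).re

/-! ### The filtered sampled process -/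

/-- The sampled sequence `Y^Δ = (Y_{nΔ})_{n ∈ ℤ}`, seen as complex valued. -/
def sampled {Ω : Type*} (Y : ℝ → Ω → ℝ) (Δ : ℝ) : ℤ → Ω → ℂ :=
  fun n x => (Y ((n : ℝ) * Δ) x : ℂ)

/-- The polynomial `φ(z) = ∏_j (1 - e^{λ_j Δ} z)`, the product being over the complex zeroes
`λ_j` of `a`, counted with multiplicity. -/
def filterPoly (a : Polynomial ℝ) (Δ : ℝ) : Polynomial ℂ :=
  ((a.aroots ℂ).map fun l =>
    1 - Polynomial.C (Complex.exp (l * (Δ : ℂ))) * Polynomial.X).prod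

/-- `φ(B) U`, where `B` is the backward shift `(B U)_n = U_{n-1}`. -/
def applyFilter {Ω : Type*} (φ : Polynomial ℂ) (U : ℤ → Ω → ℂ) : ℤ → Ω → ℂ :=
  fun n x => ∑ k ∈ Finset.range (φ.natDegree + 1), φ.coeff k * U (n - (k : ℤ)) x

/-- The filtered sampled sequence `(φ(B) Y^Δ_n)_{n ∈ ℤ}`, i.e. the moving average part of the
ARMA representation `φ(B) Y^Δ_n = θ(B) Z_n`. -/
def filteredSample {Ω : Type*} (a : Polynomial ℝ) (Y : ℝ → Ω → ℝ) (Δ : ℝ) : ℤ → Ω → ℂ :=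
  applyFilter (filterPoly a Δ) (sampled Y Δ)

/-- `f_MA` for sampling step `Δ`, at the frequency `w`. -/
def fMA {Ω : Type*} [MeasurableSpace Ω] (μ : Measure Ω) (a : Polynomial ℝ) (Y : ℝ → Ω → ℝ)
    (Δ w : ℝ) : ℝ :=
  spectralDensity μ (filteredSample a Y Δ) w

/-- `f(Δ) ∼ g(Δ)` as `Δ ↓ 0`: the ratio `f(Δ) / g(Δ)` tends to `1`. -/
def SimZero (f g : ℝ → ℝ) : Prop :=
  Tendsto (fun Δ => f Δ / g Δ) (𝓝[>] 0) (𝓝 1)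

end CARMA

end

/-!
The sampled state `X_{mΔ}` obeys a linear recursion with matrix `E = e^{ΔA}`, and its innovations
`R_m = X_{mΔ} - E X_{(m-1)Δ}` are, path by path, limits of step sums for the stochastic integral
`∫ e^{(mΔ - u)A} e_p dL_u` over `((m-1)Δ, mΔ]` (`SolvesPath.tendsto_sum`). Because every factor
`1 - e^{λΔ} e^{-ΔA}` is divisible by `A - λ` and `a(A) = 0`, the filter `φ(B)` annihilates the
homogeneous solutions (`sum_filterPoly_smul_expFlow_pow`). What remains is a finite moving sum
`∑_{i < p} c_i R_{n-i}` of the innovations, whatever the initial value of the state is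
(`isMovingSum_filteredSample`).

The increments of `L` have covariances `σ²` times the length of the overlap of the time intervals
(`IsSecondOrderLevy.integral_sub_mul_sub`). Hence the step sums converge in `L²` to the same limits,
and the isometry property (`IsStepLimit.integral_mul_conj`) makes the innovations uncorrelated, with
a covariance matrix given by integrals over `[0, Δ]`. The autocovariances of the moving sum have
finite support, and its spectral density is
`σ² / (2π) ∫_0^Δ |∑_{i < p} e^{-iωi} ∑_{k ≤ i} φ_k g(r + (i-k)Δ)|² dr`, where `g(t) = bᵀ e^{tA} e_p`
is the impulse response (`fMA_eq`).

Put `m = p - q - 1`. Then `g(t) = t^m G(t)` with `G` continuous and `G(0) = 1 / m!`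
(`impulse_zero`, `exists_eq_pow_mul`). The substitution `r = Δx` pulls out the factor `Δ^(2m+1)`,
and the remaining integral is continuous in `Δ` up to `Δ = 0`, where `φ(z) = (1 - z)^p`
(`simZero_of_integral_eq`). The limit is then read off from the generating functions
`(1 - z)^(m+1) ∑_n (x + n)^m z^n`, which are polynomials in `z` of degree at most `m`: the other `q`
factors `1 - z`, at `z = e^{-iω}`, give `2^q (1 - cos ω)^q`.
-/

namespace CARMA

/-! ### Second moments of the Lévy increments -/

section LevyMoments

variable {Ω : Type*} [MeasurableSpace Ω] {μ : Measure Ω} {L : ℝ → Ω → ℝ} {σ : ℝ}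

/-- A nonnegative function that is additive on `[0, ∞)` is linear there: it is monotone, and
`n * v x` lies between `⌊n * x⌋ * v 1` and `(⌊n * x⌋ + 1) * v 1` for every `n`. -/
lemma eq_mul_of_additive_nonneg {v : ℝ → ℝ} (h0 : ∀ t, 0 ≤ v t)
    (hadd : ∀ s t, 0 ≤ s → 0 ≤ t → v (s + t) = v s + v t) {x : ℝ} (hx : 0 ≤ x) :
    v x = x * v 1 := by
  have hz : v 0 = 0 := by have := hadd 0 0 le_rfl le_rfl; simp at this; exact this
  have hmul : ∀ (n : ℕ) (y : ℝ), 0 ≤ y → v (n * y) = n * v y := by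
    intro n y hy
    induction n with
    | zero => simp [hz]
    | succ n ih =>
      have : ((n + 1 : ℕ) : ℝ) * y = n * y + y := by push_cast; ring
      rw [this, hadd _ _ (by positivity) hy, ih]; push_cast; ring
  have hmono : ∀ s t, 0 ≤ s → s ≤ t → v s ≤ v t := by
    intro s t hs hst
    have := hadd s (t - s) hs (by linarith)
    rw [add_sub_cancel] at this
    linarith [h0 (t - s)]
  have hnat : ∀ n : ℕ, v n = n * v 1 := by
    intro n; have := hmul n 1 zero_le_one; rwa [mul_one] at this
  have key : ∀ n : ℕ, (n : ℝ) * |v x - x * v 1| ≤ v 1 := by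
    intro n
    have hnx : 0 ≤ (n : ℝ) * x := by positivity
    have h1 : v (⌊(n : ℝ) * x⌋₊ : ℝ) ≤ v (n * x) :=
      hmono _ _ (by positivity) (Nat.floor_le hnx)
    have h2 : v (n * x) ≤ v ((⌊(n : ℝ) * x⌋₊ + 1 : ℕ) : ℝ) :=
      hmono _ _ hnx (by push_cast; exact (Nat.lt_floor_add_one _).le)
    rw [hnat, hmul n x hx] at h1 h2
    push_cast at h2
    have h3 := Nat.floor_le hnx
    have h4 := (Nat.lt_floor_add_one ((n : ℝ) * x)).le
    have h5 := mul_le_mul_of_nonneg_right h3 (h0 1)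
    have h6 := mul_le_mul_of_nonneg_right h4 (h0 1)
    have : (n : ℝ) * |v x - x * v 1| = |n * v x - n * x * v 1| := by
      rw [show (n : ℝ) * v x - n * x * v 1 = n * (v x - x * v 1) by ring, abs_mul, Nat.abs_cast]
    rw [this, abs_le]
    constructor <;> nlinarith
  by_contra hne
  have hpos : 0 < |v x - x * v 1| := abs_pos.2 (sub_ne_zero.2 hne)
  obtain ⟨n, hn⟩ := exists_nat_gt (v 1 / |v x - x * v 1|)
  rw [div_lt_iff₀ hpos] at hn
  linarith [key n]

lemma IsSecondOrderLevy.memLp_sub (hL : IsSecondOrderLevy μ L σ) (s t : ℝ) :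
    MemLp (fun x => L t x - L s x) 2 μ := (hL.memLp t).sub (hL.memLp s)

lemma IsSecondOrderLevy.integral_sub_sq_eq (hL : IsSecondOrderLevy μ L σ) (s t : ℝ) :
    ∫ x, (L t x - L s x) ^ 2 ∂μ = ∫ x, L (t - s) x ^ 2 ∂μ := by
  have h1 := hL.stationary_increments 0 (t - s) s
  have h2 : ∫ x, (L (t - s + s) x - L (0 + s) x) ^ 2 ∂μ = ∫ x, (L (t - s) x - L 0 x) ^ 2 ∂μ :=
    (h1.comp (measurable_id.pow_const 2)).integral_eq
  rw [sub_add_cancel, zero_add] at h2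
  rw [h2]
  apply integral_congr_ae
  filter_upwards [hL.zero] with x hx
  rw [hx, sub_zero]

lemma IsSecondOrderLevy.integral_sub_sq [IsProbabilityMeasure μ] (hL : IsSecondOrderLevy μ L σ)
    (s t : ℝ) :
    ∫ x, (L t x - L s x) ^ 2 ∂μ = σ ^ 2 * |t - s| := by
  set v : ℝ → ℝ := fun t => ∫ x, L t x ^ 2 ∂μ with hv
  have hadd : ∀ s t, 0 ≤ s → 0 ≤ t → v (s + t) = v s + v t := by
    intro s t hs ht
    have hind : IndepFun (fun x => L s x - L 0 x) (fun x => L (s + t) x - L s x) μ :=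
      hL.indep_increments.indepFun_sub_sub hs (by linarith)
    have hprod : ∫ x, (L s x - L 0 x) * (L (s + t) x - L s x) ∂μ = 0 := by
      rw [hind.integral_fun_mul_eq_mul_integral
        (hL.memLp_sub 0 s).1 (hL.memLp_sub s (s + t)).1,
        integral_sub ((hL.memLp s).integrable (by norm_num))
          ((hL.memLp 0).integrable (by norm_num)), hL.mean_zero, hL.mean_zero]
      simp
    have i1 := (hL.memLp_sub 0 s).integrable_sq
    have i2 := (hL.memLp_sub s (s + t)).integrable_sq
    have i3 : Integrable (fun x => (L s x - L 0 x) * (L (s + t) x - L s x)) μ :=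
      (hL.memLp_sub 0 s).integrable_mul (hL.memLp_sub s (s + t))
    have e0 : v (s + t) = ∫ x, (L (s + t) x - L 0 x) ^ 2 ∂μ := by
      rw [hL.integral_sub_sq_eq, sub_zero]
    have e1 : v s = ∫ x, (L s x - L 0 x) ^ 2 ∂μ := by
      rw [hL.integral_sub_sq_eq, sub_zero]
    have e2 : v t = ∫ x, (L (s + t) x - L s x) ^ 2 ∂μ := by
      rw [hL.integral_sub_sq_eq, add_sub_cancel_left]
    have : ∫ x, (L (s + t) x - L 0 x) ^ 2 ∂μ = ∫ x, ((L s x - L 0 x) ^ 2 +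
        (L (s + t) x - L s x) ^ 2 + 2 * ((L s x - L 0 x) * (L (s + t) x - L s x))) ∂μ :=
      integral_congr_ae (Eventually.of_forall fun x => by simp only; ring)
    have i4 : Integrable (fun x => (L s x - L 0 x) ^ 2 + (L (s + t) x - L s x) ^ 2) μ := i1.add i2
    rw [e0, this, integral_add i4 (i3.const_mul 2), integral_add i1 i2,
      integral_const_mul, hprod, e1, e2]
    ring
  have h0 : ∀ t, 0 ≤ v t := fun t => integral_nonneg fun x => sq_nonneg _
  have h1 : v 1 = σ ^ 2 := hL.variance_one
  rcases le_total s t with h | h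
  · rw [hL.integral_sub_sq_eq, abs_of_nonneg (sub_nonneg.2 h), mul_comm, ← h1]
    exact eq_mul_of_additive_nonneg h0 hadd (sub_nonneg.2 h)
  · have : ∫ x, (L t x - L s x) ^ 2 ∂μ = ∫ x, (L s x - L t x) ^ 2 ∂μ :=
      integral_congr_ae (Eventually.of_forall fun x => by simp only; ring)
    rw [this, hL.integral_sub_sq_eq, abs_sub_comm, abs_of_nonneg (sub_nonneg.2 h), mul_comm, ← h1]
    exact eq_mul_of_additive_nonneg h0 hadd (sub_nonneg.2 h)

/-- The covariance of two increments is `σ ^ 2` times the length of the overlap of the two time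
intervals. By polarization it only depends on the variances of increments. -/
lemma IsSecondOrderLevy.integral_sub_mul_sub [IsProbabilityMeasure μ]
    (hL : IsSecondOrderLevy μ L σ) {s t s' t' : ℝ} (h : s ≤ t) (h' : s' ≤ t') :
    ∫ x, (L t x - L s x) * (L t' x - L s' x) ∂μ =
      σ ^ 2 * volume.real (Set.Ioc s t ∩ Set.Ioc s' t') := by
  have hi : ∀ a b, Integrable (fun x => (L b x - L a x) ^ 2) μ :=
    fun a b => (hL.memLp_sub a b).integrable_sq
  have hi2 : ∀ a b c d, Integrable (fun x => (L b x - L a x) ^ 2 + (L d x - L c x) ^ 2) μ :=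
    fun a b c d => (hi a b).add (hi c d)
  have e : ∫ x, (L t x - L s x) * (L t' x - L s' x) ∂μ =
      ∫ x, (1 / 2 : ℝ) * (((L t x - L s' x) ^ 2 + (L s x - L t' x) ^ 2) -
        ((L t x - L t' x) ^ 2 + (L s x - L s' x) ^ 2)) ∂μ :=
    integral_congr_ae (Eventually.of_forall fun x => by simp only; ring)
  rw [e, integral_const_mul, integral_sub (hi2 _ _ _ _) (hi2 _ _ _ _),
    integral_add (hi _ _) (hi _ _), integral_add (hi _ _) (hi _ _)]
  simp only [hL.integral_sub_sq]
  rw [Set.Ioc_inter_Ioc, Measure.real, Real.volume_Ioc, ENNReal.toReal_ofReal', ← mul_add,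
    ← mul_add, ← mul_sub, ← mul_assoc, mul_comm (1 / 2 : ℝ), mul_assoc]
  congr 1
  simp only [max_def, min_def, abs_eq_max_neg]
  split_ifs <;> linarith

end LevyMoments

/-! ### Step sums against a Lévy process and their limits in `L²` -/

/-- The `i`-th point of the uniform partition of `[s, t]` into `N` intervals. -/
noncomputable def gridPt (s t : ℝ) (N i : ℕ) : ℝ := s + i * ((t - s) / N)

/-- The left-endpoint step sum approximating `∫_s^t k(t - u) dL_u` along the uniform partition
of `[s, t]` into `N` intervals. -/
noncomputable def stepSum {Ω : Type*} (L : ℝ → Ω → ℝ) (k : ℝ → ℂ) (s t : ℝ) (N : ℕ) (x : Ω) : ℂ :=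
  ∑ i ∈ Finset.range N, k (t - gridPt s t N i) *
    ((L (gridPt s t N (i + 1)) x - L (gridPt s t N i) x : ℝ) : ℂ)

/-- The step function of which `stepSum` is the integral. -/
noncomputable def stepFun (k : ℝ → ℂ) (s t : ℝ) (N : ℕ) (u : ℝ) : ℂ :=
  ∑ i ∈ Finset.range N,
    (Set.Ioc (gridPt s t N i) (gridPt s t N (i + 1))).indicator (fun _ => k (t - gridPt s t N i)) u

lemma gridPt_zero (s t : ℝ) (N : ℕ) : gridPt s t N 0 = s := by simp [gridPt]

lemma gridPt_self (s t : ℝ) {N : ℕ} (hN : N ≠ 0) : gridPt s t N N = t := by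
  have : (N : ℝ) ≠ 0 := Nat.cast_ne_zero.2 hN
  rw [gridPt]; field_simp; ring

lemma gridPt_succ (s t : ℝ) (N i : ℕ) : gridPt s t N (i + 1) = gridPt s t N i + (t - s) / N := by
  simp only [gridPt]; push_cast; ring

lemma gridPt_mono {s t : ℝ} (h : s ≤ t) (N : ℕ) : Monotone (gridPt s t N) :=
  monotone_nat_of_le_succ fun i => by
    rw [gridPt_succ]
    have : 0 ≤ (t - s) / N := div_nonneg (sub_nonneg.2 h) (Nat.cast_nonneg N)
    linarith

lemma gridPt_mem_Icc {s t : ℝ} (h : s ≤ t) {N i : ℕ} (hi : i ≤ N) :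
    gridPt s t N i ∈ Set.Icc s t := by
  refine ⟨(gridPt_zero s t N).symm.le.trans (gridPt_mono h N (Nat.zero_le i)), ?_⟩
  rcases eq_or_ne N 0 with rfl | hN
  · simpa [gridPt] using h
  · exact (gridPt_mono h N hi).trans (gridPt_self s t hN).le

lemma sum_indicator_Ioc_of_monotone {u : ℕ → ℝ} (hu : Monotone u) (n : ℕ) (x : ℝ) :
    ∑ i ∈ Finset.range n, (Set.Ioc (u i) (u (i + 1))).indicator (fun _ => (1 : ℝ)) x =
      (Set.Ioc (u 0) (u n)).indicator (fun _ => (1 : ℝ)) x := by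
  induction n with
  | zero => simp
  | succ n ih =>
    have h1 := hu (Nat.zero_le n)
    have h2 := hu (Nat.le_succ n)
    rw [Finset.sum_range_succ, ih, ← Set.Ioc_union_Ioc_eq_Ioc h1 h2,
      Set.indicator_union_of_disjoint (Set.Ioc_disjoint_Ioc_of_le le_rfl)]

lemma norm_sum_indicator_grid_le {E : Type*} [NormedAddCommGroup E] {s t : ℝ} (h : s ≤ t) (N : ℕ)
    (u : ℝ) {c : ℕ → E} {C : ℝ}
    (hc : ∀ i < N, u ∈ Set.Ioc (gridPt s t N i) (gridPt s t N (i + 1)) → ‖c i‖ ≤ C) :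
    ‖∑ i ∈ Finset.range N,
      (Set.Ioc (gridPt s t N i) (gridPt s t N (i + 1))).indicator (fun _ => c i) u‖ ≤
      C * (Set.Ioc (gridPt s t N 0) (gridPt s t N N)).indicator (fun _ => (1 : ℝ)) u := by
  rw [← sum_indicator_Ioc_of_monotone (gridPt_mono h N), Finset.mul_sum]
  refine norm_sum_le_of_le _ fun i hi => ?_
  by_cases hu : u ∈ Set.Ioc (gridPt s t N i) (gridPt s t N (i + 1))
  · simpa [Set.indicator_of_mem hu] using hc i (Finset.mem_range.1 hi) hu
  · simp [Set.indicator_of_notMem hu]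

lemma norm_stepFun_le {k : ℝ → ℂ} {s t C : ℝ} (h : s ≤ t)
    (hC : ∀ u ∈ Set.Icc 0 (t - s), ‖k u‖ ≤ C) (N : ℕ) (u : ℝ) :
    ‖stepFun k s t N u‖ ≤ C * (Set.Ioc s t).indicator (fun _ => (1 : ℝ)) u := by
  rcases eq_or_ne N 0 with rfl | hN
  · have h0 : 0 ≤ C := (norm_nonneg _).trans (hC 0 ⟨le_rfl, sub_nonneg.2 h⟩)
    simp only [stepFun, Finset.range_zero, Finset.sum_empty, norm_zero]
    exact mul_nonneg h0 (Set.indicator_nonneg (fun _ _ => zero_le_one) _)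
  · have := norm_sum_indicator_grid_le h N u (c := fun i => k (t - gridPt s t N i)) (C := C)
      (fun i hi _ => hC _ (by
        have := gridPt_mem_Icc h (N := N) hi.le
        constructor <;> linarith [this.1, this.2]))
    rwa [gridPt_zero, gridPt_self _ _ hN] at this

lemma tendsto_stepFun {k : ℝ → ℂ} (hk : Continuous k) {s t : ℝ} (h : s ≤ t) (u : ℝ) :
    Tendsto (fun N => stepFun k s t N u) atTop
      (𝓝 ((Set.Ioc s t).indicator (fun u => k (t - u)) u)) := by
  rw [Metric.tendsto_atTop]
  intro ε hε
  have hcont : ContinuousAt (fun u => k (t - u)) u := by fun_prop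
  obtain ⟨δ, hδ, hk'⟩ := Metric.continuousAt_iff.1 hcont (ε / 2) (by positivity)
  obtain ⟨N₀, hN₀⟩ := exists_nat_gt ((t - s) / δ)
  refine ⟨N₀ + 1, fun N hN => ?_⟩
  have hNpos : (0 : ℝ) < N := by exact_mod_cast (by omega : 0 < N)
  have hN' : (t - s) / N < δ := by
    rw [div_lt_iff₀ hδ] at hN₀
    rw [div_lt_iff₀ hNpos]
    have : (N₀ : ℝ) ≤ N := by exact_mod_cast (by omega : N₀ ≤ N)
    nlinarith
  have e : stepFun k s t N u - (Set.Ioc s t).indicator (fun u => k (t - u)) u =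
      ∑ i ∈ Finset.range N, (Set.Ioc (gridPt s t N i) (gridPt s t N (i + 1))).indicator
        (fun _ => k (t - gridPt s t N i) - k (t - u)) u := by
    have h1 : (Set.Ioc s t).indicator (fun u => k (t - u)) u =
        ∑ i ∈ Finset.range N, (Set.Ioc (gridPt s t N i) (gridPt s t N (i + 1))).indicator
          (fun _ => k (t - u)) u := by
      have := sum_indicator_Ioc_of_monotone (gridPt_mono h N) N u
      rw [gridPt_zero, gridPt_self _ _ (by omega : N ≠ 0)] at this
      have h2 : ∀ A : Set ℝ, ∀ z : ℂ, A.indicator (fun _ => z) u =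
          ((A.indicator (fun _ => (1 : ℝ)) u : ℝ) : ℂ) * z := by
        intro A z; by_cases hu : u ∈ A <;> simp [hu]
      have h3 : (Set.Ioc s t).indicator (fun u => k (t - u)) u =
          (Set.Ioc s t).indicator (fun _ => k (t - u)) u := by
        by_cases hu : u ∈ Set.Ioc s t <;> simp only [Set.indicator, hu, if_true, if_false]
      rw [h3, h2, ← this]
      push_cast
      rw [Finset.sum_mul]
      exact Finset.sum_congr rfl fun i _ => (h2 _ _).symm
    rw [h1, stepFun, ← Finset.sum_sub_distrib]
    refine Finset.sum_congr rfl fun i _ => ?_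
    rw [← Pi.sub_apply, ← Set.indicator_sub']
    rfl
  rw [dist_eq_norm, e]
  refine (norm_sum_indicator_grid_le h N u (C := ε / 2) fun i _ hu => ?_).trans_lt ?_
  · rw [← dist_eq_norm]
    refine (hk' ?_).le
    rw [gridPt_succ] at hu
    rw [Real.dist_eq, abs_lt]
    constructor <;> linarith [hu.1, hu.2]
  · have : (Set.Ioc (gridPt s t N 0) (gridPt s t N N)).indicator (fun _ => (1 : ℝ)) u ≤ 1 :=
      Set.indicator_le_self' (fun _ _ => zero_le_one) _
    nlinarith

section

variable {Ω : Type*} [MeasurableSpace Ω] {μ : Measure Ω}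

lemma inner_toLp_eq {U V : Ω → ℂ} (hU : MemLp U 2 μ) (hV : MemLp V 2 μ) :
    inner ℂ (hV.toLp V) (hU.toLp U) = ∫ x, U x * (starRingEnd ℂ) (V x) ∂μ := by
  rw [L2.inner_def]
  apply integral_congr_ae
  filter_upwards [hU.coeFn_toLp, hV.coeFn_toLp] with x h1 h2
  rw [h1, h2]
  simp

/-- If the second moments `E S_n S_m^*` converge as `n, m → ∞` then `S` is Cauchy in `L²`, so an
almost sure limit of `S` is also its limit in `L²`. -/
lemma exists_tendsto_toLp {S : ℕ → Ω → ℂ} {U : Ω → ℂ} {Q : ℂ} (hS : ∀ n, MemLp (S n) 2 μ)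
    (hQ : Tendsto (fun nm : ℕ × ℕ => ∫ x, S nm.1 x * (starRingEnd ℂ) (S nm.2 x) ∂μ)
      (atTop ×ˢ atTop) (𝓝 Q))
    (hU : ∀ᵐ x ∂μ, Tendsto (fun n => S n x) atTop (𝓝 (U x))) :
    ∃ hU' : MemLp U 2 μ, Tendsto (fun n => (hS n).toLp (S n)) atTop (𝓝 (hU'.toLp U)) := by
  set G : ℕ → Lp ℂ 2 μ := fun n => (hS n).toLp (S n) with hG
  have hin : ∀ n m, inner ℂ (G m) (G n) = ∫ x, S n x * (starRingEnd ℂ) (S m x) ∂μ :=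
    fun n m => inner_toLp_eq (hS n) (hS m)
  have hsq : ∀ n m, ‖G n - G m‖ ^ 2 =
      (inner ℂ (G n) (G n) + inner ℂ (G m) (G m) - inner ℂ (G m) (G n) - inner ℂ (G n) (G m)).re := by
    intro n m
    rw [← inner_self_eq_norm_sq (𝕜 := ℂ), inner_sub_left, inner_sub_right, inner_sub_right]
    simp only [RCLike.re_to_complex, Complex.sub_re, Complex.add_re]
    ring
  have hnm : Tendsto (fun nm : ℕ × ℕ => ‖G nm.1 - G nm.2‖ ^ 2) (atTop ×ˢ atTop) (𝓝 0) := by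
    have hd1 : Tendsto (fun nm : ℕ × ℕ => (nm.1, nm.1)) (atTop ×ˢ atTop) (atTop ×ˢ atTop) :=
      tendsto_fst.prodMk tendsto_fst
    have hd2 : Tendsto (fun nm : ℕ × ℕ => (nm.2, nm.2)) (atTop ×ˢ atTop) (atTop ×ˢ atTop) :=
      tendsto_snd.prodMk tendsto_snd
    have hd3 : Tendsto (fun nm : ℕ × ℕ => (nm.2, nm.1)) (atTop ×ˢ atTop) (atTop ×ˢ atTop) :=
      tendsto_snd.prodMk tendsto_fst
    have := (Complex.continuous_re.tendsto _).comp
      ((((hQ.comp hd1).add (hQ.comp hd2)).sub hQ).sub (hQ.comp hd3))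
    simp only [hsq, hin]
    simpa [Function.comp_def] using this
  have hc : CauchySeq G := by
    rw [Metric.cauchySeq_iff]
    intro ε hε
    have := (Metric.tendsto_nhds.1 hnm) (ε ^ 2) (by positivity)
    rw [prod_atTop_atTop_eq, eventually_atTop] at this
    obtain ⟨⟨a, b⟩, hab⟩ := this
    refine ⟨max a b, fun m hm n hn => ?_⟩
    have := hab (m, n) ⟨le_trans (le_max_left _ _) hm, le_trans (le_max_right _ _) hn⟩
    rw [Real.dist_eq, sub_zero, abs_of_nonneg (by positivity)] at this
    rw [dist_eq_norm]
    exact lt_of_pow_lt_pow_left₀ 2 hε.le this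
  obtain ⟨g, hg⟩ := cauchySeq_tendsto_of_complete hc
  have hae : U =ᵐ[μ] g := by
    have h1 : TendstoInMeasure μ (fun n => G n) atTop g := tendstoInMeasure_of_tendsto_Lp hg
    obtain ⟨ns, hns, hlim⟩ := h1.exists_seq_tendsto_ae
    have hcoe : ∀ᵐ x ∂μ, ∀ n, G n x = S n x := ae_all_iff.2 fun n => (hS n).coeFn_toLp
    filter_upwards [hlim, hU, hcoe] with x h1 h2 h3
    have h4 := h2.comp hns.tendsto_atTop
    simp only [h3] at h1
    exact tendsto_nhds_unique h4 h1
  have hU' : MemLp U 2 μ := (memLp_congr_ae hae).2 (Lp.memLp g)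
  refine ⟨hU', ?_⟩
  have : hU'.toLp U = g := by
    rw [MemLp.toLp_congr hU' (Lp.memLp g) hae, Lp.toLp_coeFn]
  rwa [this]

variable {L : ℝ → Ω → ℝ} {σ : ℝ}

lemma IsSecondOrderLevy.memLp_stepSum (hL : IsSecondOrderLevy μ L σ) (k : ℝ → ℂ) (s t : ℝ)
    (N : ℕ) : MemLp (stepSum L k s t N) 2 μ := by
  unfold stepSum
  refine memLp_finsetSum _ fun i _ => ?_
  exact ((hL.memLp_sub _ _).ofReal (K := ℂ)).const_mul _

lemma IsSecondOrderLevy.integral_stepSum [IsProbabilityMeasure μ] (hL : IsSecondOrderLevy μ L σ)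
    (k : ℝ → ℂ) (s t : ℝ) (N : ℕ) : ∫ x, stepSum L k s t N x ∂μ = 0 := by
  unfold stepSum
  have hi : ∀ t, Integrable (L t) μ := fun t => (hL.memLp t).integrable (by norm_num)
  have hi2 : ∀ s t, Integrable (fun x => ((L t x - L s x : ℝ) : ℂ)) μ :=
    fun s t => ((hi t).sub (hi s)).ofReal
  rw [integral_finsetSum _ fun i _ => (hi2 _ _).const_mul _]
  refine Finset.sum_eq_zero fun i _ => ?_
  rw [integral_const_mul, integral_complex_ofReal, integral_sub (hi _) (hi _),
    hL.mean_zero, hL.mean_zero]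
  simp

/-- The isometry property on step functions. -/
lemma IsSecondOrderLevy.integral_stepSum_mul [IsProbabilityMeasure μ]
    (hL : IsSecondOrderLevy μ L σ) (k k' : ℝ → ℂ) {s t s' t' : ℝ} (h : s ≤ t) (h' : s' ≤ t')
    (N M : ℕ) :
    ∫ x, stepSum L k s t N x * (starRingEnd ℂ) (stepSum L k' s' t' M x) ∂μ =
      (σ : ℂ) ^ 2 * ∫ u, stepFun k s t N u * (starRingEnd ℂ) (stepFun k' s' t' M u) := by
  simp only [stepSum, stepFun, map_sum, Finset.sum_mul_sum]
  have hi : ∀ a b c d, Integrable (fun x => ((L b x - L a x : ℝ) : ℂ) * ((L d x - L c x : ℝ) : ℂ)) μ :=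
    fun a b c d => ((hL.memLp_sub a b).ofReal (K := ℂ)).integrable_mul
      ((hL.memLp_sub c d).ofReal (K := ℂ))
  have e1 : ∀ z w : ℂ, ∀ a b c d x, z * ((L b x - L a x : ℝ) : ℂ) * (starRingEnd ℂ)
      (w * ((L d x - L c x : ℝ) : ℂ)) =
      (z * (starRingEnd ℂ) w) * (((L b x - L a x : ℝ) : ℂ) * ((L d x - L c x : ℝ) : ℂ)) := by
    intro z w a b c d x
    rw [map_mul, Complex.conj_ofReal]; ring
  have e2 : ∀ z w : ℂ, ∀ A B : Set ℝ, ∀ u, A.indicator (fun _ => z) u * (starRingEnd ℂ)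
      (B.indicator (fun _ => w) u) = (A ∩ B).indicator (fun _ => z * (starRingEnd ℂ) w) u := by
    intro z w A B u
    by_cases hA : u ∈ A <;> by_cases hB : u ∈ B <;> simp [hA, hB]
  have hi2 : ∀ z : ℂ, ∀ a b c d : ℝ,
      Integrable ((Set.Ioc a b ∩ Set.Ioc c d).indicator (fun _ => z)) volume := by
    intro z a b c d
    rw [Set.Ioc_inter_Ioc]
    exact (integrable_indicator_iff measurableSet_Ioc).2 (integrableOn_const (by simp) (by simp))
  simp only [e1, e2]
  rw [integral_finsetSum _ fun i _ => integrable_finsetSum _ fun j _ => (hi _ _ _ _).const_mul _,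
    integral_finsetSum _ fun i _ => integrable_finsetSum _ fun j _ => hi2 _ _ _ _ _,
    Finset.mul_sum]
  refine Finset.sum_congr rfl fun i _ => ?_
  rw [integral_finsetSum _ fun j _ => (hi _ _ _ _).const_mul _,
    integral_finsetSum _ fun j _ => hi2 _ _ _ _ _, Finset.mul_sum]
  refine Finset.sum_congr rfl fun j _ => ?_
  have e3 := hL.integral_sub_mul_sub (gridPt_mono h N (Nat.le_succ i))
    (gridPt_mono h' M (Nat.le_succ j))
  rw [integral_const_mul, integral_indicator (measurableSet_Ioc.inter measurableSet_Ioc),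
    setIntegral_const, Complex.real_smul]
  simp only [← Complex.ofReal_mul]
  rw [integral_complex_ofReal, e3]
  push_cast
  ring

/-- `U` is the almost sure limit of the left-endpoint step sums for `∫_s^t k(t - u) dL_u` along
uniform partitions. -/
def IsStepLimit (μ : Measure Ω) (L : ℝ → Ω → ℝ) (k : ℝ → ℂ) (s t : ℝ) (U : Ω → ℂ) : Prop :=
  ∀ᵐ x ∂μ, Tendsto (fun N => stepSum L k s t N x) atTop (𝓝 (U x))

lemma tendsto_integral_stepFun {k k' : ℝ → ℂ} (hk : Continuous k) (hk' : Continuous k')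
    {s t s' t' : ℝ} (h : s ≤ t) (h' : s' ≤ t') :
    Tendsto (fun nm : ℕ × ℕ => ∫ u, stepFun k s t nm.1 u * (starRingEnd ℂ) (stepFun k' s' t' nm.2 u))
      (atTop ×ˢ atTop) (𝓝 (∫ u, (Set.Ioc s t).indicator (fun u => k (t - u)) u *
        (starRingEnd ℂ) ((Set.Ioc s' t').indicator (fun u => k' (t' - u)) u))) := by
  obtain ⟨C, hC⟩ := (isCompact_Icc (a := (0 : ℝ)) (b := t - s)).exists_bound_of_continuousOn
    hk.continuousOn
  obtain ⟨C', hC'⟩ := (isCompact_Icc (a := (0 : ℝ)) (b := t' - s')).exists_bound_of_continuousOn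
    hk'.continuousOn
  have hm : ∀ (k : ℝ → ℂ) s t N, Measurable (stepFun k s t N) := fun k s t N =>
    Finset.measurable_fun_sum _ fun i _ => measurable_const.indicator measurableSet_Ioc
  refine tendsto_integral_filter_of_dominated_convergence
    (fun u => (C * (Set.Ioc s t).indicator (fun _ => (1 : ℝ)) u) * C') ?_ ?_ ?_ ?_
  · exact Eventually.of_forall fun nm => ((hm k s t nm.1).mul
      (Complex.continuous_conj.measurable.comp (hm k' s' t' nm.2))).aestronglyMeasurable
  · refine Eventually.of_forall fun nm => Eventually.of_forall fun u => ?_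
    rw [norm_mul, RCLike.norm_conj]
    have h1 := norm_stepFun_le h hC nm.1 u
    have h2 := norm_stepFun_le h' hC' nm.2 u
    have h3 : (Set.Ioc s' t').indicator (fun _ => (1 : ℝ)) u ≤ 1 :=
      Set.indicator_le_self' (fun _ _ => zero_le_one) _
    have h4 : 0 ≤ C' := (norm_nonneg _).trans (hC' 0 ⟨le_rfl, sub_nonneg.2 h'⟩)
    exact mul_le_mul h1 (h2.trans (mul_le_of_le_one_right h4 h3)) (norm_nonneg _)
      ((norm_nonneg _).trans h1)
  · refine (Integrable.const_mul ?_ C).mul_const C'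
    exact (integrable_indicator_iff measurableSet_Ioc).2 (integrableOn_const (by simp) (by simp))
  · refine Eventually.of_forall fun u => ?_
    exact ((tendsto_stepFun hk h u).comp tendsto_fst).mul
      ((Complex.continuous_conj.tendsto _).comp ((tendsto_stepFun hk' h' u).comp tendsto_snd))

lemma IsStepLimit.exists_tendsto_toLp [IsProbabilityMeasure μ] (hL : IsSecondOrderLevy μ L σ)
    {k : ℝ → ℂ} (hk : Continuous k) {s t : ℝ} (h : s ≤ t) {U : Ω → ℂ}
    (hU : IsStepLimit μ L k s t U) :
    ∃ hU' : MemLp U 2 μ, Tendsto (fun N => (hL.memLp_stepSum k s t N).toLp (stepSum L k s t N))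
      atTop (𝓝 (hU'.toLp U)) := by
  have := (tendsto_integral_stepFun hk hk h h).const_mul ((σ : ℂ) ^ 2)
  simp only [← hL.integral_stepSum_mul k k h h] at this
  exact CARMA.exists_tendsto_toLp (hL.memLp_stepSum k s t) this hU

lemma IsStepLimit.memLp [IsProbabilityMeasure μ] (hL : IsSecondOrderLevy μ L σ)
    {k : ℝ → ℂ} (hk : Continuous k) {s t : ℝ} (h : s ≤ t) {U : Ω → ℂ}
    (hU : IsStepLimit μ L k s t U) : MemLp U 2 μ :=
  (hU.exists_tendsto_toLp hL hk h).1

lemma IsStepLimit.integral_eq_zero [IsProbabilityMeasure μ] (hL : IsSecondOrderLevy μ L σ)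
    {k : ℝ → ℂ} (hk : Continuous k) {s t : ℝ} (h : s ≤ t) {U : Ω → ℂ}
    (hU : IsStepLimit μ L k s t U) : ∫ x, U x ∂μ = 0 := by
  obtain ⟨hU', hlim⟩ := hU.exists_tendsto_toLp hL hk h
  have h1 : MemLp (fun _ : Ω => (1 : ℂ)) 2 μ := memLp_const 1
  have := (tendsto_const_nhds (x := h1.toLp (fun _ : Ω => (1 : ℂ)))).inner (𝕜 := ℂ) hlim
  simp only [inner_toLp_eq, map_one, mul_one, hL.integral_stepSum] at this
  exact tendsto_nhds_unique this tendsto_const_nhds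

/-- The isometry property of the integrals of continuous kernels. -/
lemma IsStepLimit.integral_mul_conj [IsProbabilityMeasure μ] (hL : IsSecondOrderLevy μ L σ)
    {k k' : ℝ → ℂ} (hk : Continuous k) (hk' : Continuous k') {s t s' t' : ℝ} (h : s ≤ t)
    (h' : s' ≤ t') {U V : Ω → ℂ} (hU : IsStepLimit μ L k s t U) (hV : IsStepLimit μ L k' s' t' V) :
    ∫ x, U x * (starRingEnd ℂ) (V x) ∂μ =
      (σ : ℂ) ^ 2 * ∫ u, (Set.Ioc s t).indicator (fun u => k (t - u)) u *
        (starRingEnd ℂ) ((Set.Ioc s' t').indicator (fun u => k' (t' - u)) u) := by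
  obtain ⟨hU', hlimU⟩ := hU.exists_tendsto_toLp hL hk h
  obtain ⟨hV', hlimV⟩ := hV.exists_tendsto_toLp hL hk' h'
  have h1 := hlimV.inner (𝕜 := ℂ) hlimU
  simp only [inner_toLp_eq, hL.integral_stepSum_mul k k' h h'] at h1
  have h2 : Tendsto (fun n : ℕ => (n, n)) atTop (atTop ×ˢ atTop) := tendsto_id.prodMk tendsto_id
  exact tendsto_nhds_unique h1 (((tendsto_integral_stepFun hk hk' h h').comp h2).const_mul _)

lemma IsStepLimit.integral_mul_conj_of_le [IsProbabilityMeasure μ]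
    (hL : IsSecondOrderLevy μ L σ) {k k' : ℝ → ℂ} (hk : Continuous k) (hk' : Continuous k')
    {s t s' t' : ℝ} (h : s ≤ t) (h' : s' ≤ t') {U V : Ω → ℂ} (hU : IsStepLimit μ L k s t U)
    (hV : IsStepLimit μ L k' s' t' V) (hd : t ≤ s' ∨ t' ≤ s) :
    ∫ x, U x * (starRingEnd ℂ) (V x) ∂μ = 0 := by
  rw [hU.integral_mul_conj hL hk hk' h h' hV]
  have : ∀ u, (Set.Ioc s t).indicator (fun u => k (t - u)) u *
        (starRingEnd ℂ) ((Set.Ioc s' t').indicator (fun u => k' (t' - u)) u) = 0 := by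
    intro u
    by_cases h1 : u ∈ Set.Ioc s t
    · have h2 : u ∉ Set.Ioc s' t' := fun h2 => by
        rcases hd with hd | hd <;> linarith [h1.1, h1.2, h2.1, h2.2]
      simp [h2]
    · simp [h1]
  simp [this]

lemma IsStepLimit.integral_mul_conj_same [IsProbabilityMeasure μ]
    (hL : IsSecondOrderLevy μ L σ) {k k' : ℝ → ℂ} (hk : Continuous k) (hk' : Continuous k')
    {s t : ℝ} (h : s ≤ t) {U V : Ω → ℂ} (hU : IsStepLimit μ L k s t U)
    (hV : IsStepLimit μ L k' s t V) :
    ∫ x, U x * (starRingEnd ℂ) (V x) ∂μ =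
      (σ : ℂ) ^ 2 * ∫ r in (0 : ℝ)..(t - s), k r * (starRingEnd ℂ) (k' r) := by
  rw [hU.integral_mul_conj hL hk hk' h h hV]
  have : ∀ u, (Set.Ioc s t).indicator (fun u => k (t - u)) u *
        (starRingEnd ℂ) ((Set.Ioc s t).indicator (fun u => k' (t - u)) u) =
        (Set.Ioc s t).indicator (fun u => k (t - u) * (starRingEnd ℂ) (k' (t - u))) u := by
    intro u
    by_cases h1 : u ∈ Set.Ioc s t <;> simp [h1]
  simp only [this]
  rw [integral_indicator measurableSet_Ioc, ← intervalIntegral.integral_of_le h,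
    intervalIntegral.integral_comp_sub_left (fun r => k r * (starRingEnd ℂ) (k' r)) t, sub_self]

end

/-! ### Pathwise variation of constants -/

section Flow

variable {V : Type*} [NormedAddCommGroup V] [NormedSpace ℂ V]

/-- The flow `e^{tT}` of a bounded operator `T`, at real times. -/
noncomputable def expFlow (T : V →L[ℂ] V) (t : ℝ) : V →L[ℂ] V := NormedSpace.exp ((t : ℂ) • T)

lemma expFlow_zero (T : V →L[ℂ] V) : expFlow T 0 = 1 := by
  simp [expFlow, NormedSpace.exp_zero]

lemma commute_expFlow (T : V →L[ℂ] V) (t : ℝ) : Commute T (expFlow T t) :=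
  ((Commute.refl T).smul_right _).exp_right

variable [CompleteSpace V]

lemma expFlow_add (T : V →L[ℂ] V) (s t : ℝ) : expFlow T (s + t) = expFlow T s * expFlow T t := by
  rw [expFlow, expFlow, expFlow, Complex.ofReal_add, add_smul]
  let : NormedAlgebra ℚ (V →L[ℂ] V) := NormedAlgebra.restrictScalars ℚ ℂ (V →L[ℂ] V)
  exact NormedSpace.exp_add_of_commute (((Commute.refl T).smul_left _).smul_right _)

lemma hasDerivAt_expFlow (T : V →L[ℂ] V) (t : ℝ) :
    HasDerivAt (expFlow T) (T * expFlow T t) t := by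
  have := (hasDerivAt_exp_smul_const' T (t : ℂ)).scomp t Complex.ofRealCLM.hasDerivAt
  simpa [Function.comp_def] using! this

lemma continuous_expFlow (T : V →L[ℂ] V) : Continuous (expFlow T) :=
  continuous_iff_continuousAt.2 fun t => (hasDerivAt_expFlow T t).continuousAt

lemma expFlow_nat_mul (T : V →L[ℂ] V) (t : ℝ) (n : ℕ) : expFlow T (n * t) = expFlow T t ^ n := by
  induction n with
  | zero => simp [expFlow_zero]
  | succ n ih => rw [pow_succ, ← ih, ← expFlow_add]; congr 1; push_cast; ring

end Flow

/-- A function with right and left limits everywhere is bounded on compact intervals. -/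
lemma exists_bound_of_cadlag {f : ℝ → ℝ} (hf : ∀ t : ℝ, ContinuousWithinAt f (Set.Ici t) t ∧
    ∃ l : ℝ, Tendsto f (𝓝[<] t) (𝓝 l)) (s t : ℝ) : ∃ C, ∀ u ∈ Set.Icc s t, |f u| ≤ C := by
  refine (isCompact_Icc (a := s) (b := t)).induction_on (p := fun S => ∃ C, ∀ u ∈ S, |f u| ≤ C)
    ⟨0, by simp⟩ ?_ ?_ ?_
  · rintro S S' hS ⟨C, hC⟩
    exact ⟨C, fun u hu => hC u (hS hu)⟩
  · rintro S S' ⟨C, hC⟩ ⟨C', hC'⟩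
    exact ⟨max C C', fun u hu => hu.elim (fun h => (hC u h).trans (le_max_left _ _))
      fun h => (hC' u h).trans (le_max_right _ _)⟩
  · intro u _
    obtain ⟨h1, l, h2⟩ := hf u
    have e1 : ∀ᶠ v in 𝓝[≥] u, |f v| ≤ |f u| + 1 :=
      (h1.abs.eventually_lt_const (lt_add_one _)).mono fun _ h => h.le
    have e2 : ∀ᶠ v in 𝓝[<] u, |f v| ≤ |l| + 1 :=
      (h2.abs.eventually_lt_const (lt_add_one _)).mono fun _ h => h.le
    have e3 : ∀ᶠ v in 𝓝 u, |f v| ≤ max (|f u| + 1) (|l| + 1) := by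
      rw [← nhdsLT_sup_nhdsGE, eventually_sup]
      exact ⟨e2.mono fun _ h => h.trans (le_max_right _ _),
        e1.mono fun _ h => h.trans (le_max_left _ _)⟩
    exact ⟨_, nhdsWithin_le_nhds e3, _, fun v hv => hv⟩

section Path

variable {V : Type*} [NormedAddCommGroup V] [NormedSpace ℂ V]
  {T : V →L[ℂ] V} {e : V} {x : ℝ → V} {l : ℝ → ℝ}

/-- The path `x` solves `dx = T x dt + e dl` in integrated form, with a càdlàg driving path `l`. -/
structure SolvesPath (T : V →L[ℂ] V) (e : V) (x : ℝ → V) (l : ℝ → ℝ) : Prop where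
  cadlag : ∀ t : ℝ, ContinuousWithinAt l (Set.Ici t) t ∧ ∃ y : ℝ, Tendsto l (𝓝[<] t) (𝓝 y)
  integrable : ∀ s t : ℝ, IntervalIntegrable x volume s t
  equation : ∀ s t : ℝ, s ≤ t → x t - x s = (∫ u in s..t, T (x u)) + ((l t - l s : ℝ) : ℂ) • e

lemma SolvesPath.integrable_map (hx : SolvesPath T e x l) (s t : ℝ) :
    IntervalIntegrable (fun u => T (x u)) volume s t :=
  ⟨T.integrable_comp (hx.integrable s t).1, T.integrable_comp (hx.integrable s t).2⟩

lemma SolvesPath.continuousWithinAt [CompleteSpace V] (hx : SolvesPath T e x l) (t : ℝ) :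
    ContinuousWithinAt x (Set.Ici t) t := by
  have h1 : ∀ u ∈ Set.Ici t, x u = x t + ((∫ v in t..u, T (x v)) + ((l u - l t : ℝ) : ℂ) • e) :=
    fun u hu => by rw [← hx.equation t u hu]; abel
  have h2 : Continuous fun u => ∫ v in t..u, T (x v) :=
    intervalIntegral.continuous_primitive hx.integrable_map t
  have h3 : ContinuousWithinAt (fun u => ((l u - l t : ℝ) : ℂ) • e) (Set.Ici t) t :=
    (Complex.continuous_ofReal.continuousAt.comp_continuousWithinAt
      ((hx.cadlag t).1.sub continuousWithinAt_const)).smul continuousWithinAt_const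
  exact ((continuousWithinAt_const.add (h2.continuousWithinAt.add h3))).congr h1
    (h1 t (Set.mem_Ici.2 le_rfl))

lemma SolvesPath.exists_bound [CompleteSpace V] (hx : SolvesPath T e x l) (s t : ℝ) :
    ∃ B, ∀ u ∈ Set.Icc s t, ‖x u‖ ≤ B := by
  obtain ⟨C, hC⟩ := exists_bound_of_cadlag hx.cadlag s t
  have h2 : Continuous fun u => ∫ v in s..u, T (x v) :=
    intervalIntegral.continuous_primitive hx.integrable_map s
  obtain ⟨D, hD⟩ := (isCompact_Icc (a := s) (b := t)).exists_bound_of_continuousOn h2.continuousOn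
  refine ⟨‖x s‖ + (D + (C + |l s|) * ‖e‖), fun u hu => ?_⟩
  have h1 : x u = x s + ((∫ v in s..u, T (x v)) + ((l u - l s : ℝ) : ℂ) • e) := by
    rw [← hx.equation s u hu.1]; abel
  rw [h1]
  refine (norm_add_le _ _).trans (add_le_add le_rfl ((norm_add_le _ _).trans
    (add_le_add (hD u hu) ?_)))
  rw [norm_smul, Complex.norm_real, Real.norm_eq_abs]
  refine mul_le_mul_of_nonneg_right ((abs_sub _ _).trans (add_le_add (hC u hu) le_rfl))
    (norm_nonneg _)

/-- The right end point of the cell of the partition of `[s, t]` into `N` intervals that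
contains `u`. -/
noncomputable def cellEnd (s t : ℝ) (N : ℕ) (u : ℝ) : ℝ :=
  s + ⌈(u - s) / ((t - s) / N)⌉ * ((t - s) / N)

lemma cellEnd_eq {s t : ℝ} (h : s < t) {N : ℕ} (hN : N ≠ 0) {i : ℕ} {u : ℝ}
    (hu : u ∈ Set.Ioc (gridPt s t N i) (gridPt s t N (i + 1))) :
    cellEnd s t N u = gridPt s t N (i + 1) := by
  have hh : 0 < (t - s) / N := div_pos (sub_pos.2 h) (by positivity)
  have : ⌈(u - s) / ((t - s) / N)⌉ = (i : ℤ) + 1 := by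
    rw [Int.ceil_eq_iff, lt_div_iff₀ hh, div_le_iff₀ hh]
    simp only [gridPt] at hu
    push_cast at hu ⊢
    constructor <;> linarith [hu.1, hu.2]
  rw [cellEnd, this, gridPt]; push_cast; rfl

lemma le_cellEnd {s t : ℝ} (h : s < t) {N : ℕ} (hN : N ≠ 0) (u : ℝ) : u ≤ cellEnd s t N u := by
  have hh : 0 < (t - s) / N := div_pos (sub_pos.2 h) (by positivity)
  have := Int.le_ceil ((u - s) / ((t - s) / N))
  rw [div_le_iff₀ hh] at this
  rw [cellEnd]; linarith

lemma cellEnd_le {s t : ℝ} (h : s < t) {N : ℕ} (hN : N ≠ 0) (u : ℝ) :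
    cellEnd s t N u ≤ u + (t - s) / N := by
  have hh : 0 < (t - s) / N := div_pos (sub_pos.2 h) (by positivity)
  have := (Int.ceil_lt_add_one ((u - s) / ((t - s) / N))).le
  rw [cellEnd]
  have h2 := mul_le_mul_of_nonneg_right this hh.le
  rw [add_mul, div_mul_cancel₀ _ hh.ne'] at h2
  linarith

lemma tendsto_cellEnd {s t : ℝ} (h : s < t) (u : ℝ) :
    Tendsto (fun N => cellEnd s t N u) atTop (𝓝[≥] u) := by
  refine tendsto_nhdsWithin_iff.2 ⟨?_, ?_⟩
  · have h1 : Tendsto (fun N : ℕ => u + (t - s) / N) atTop (𝓝 u) := by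
      simpa using tendsto_const_nhds.add (tendsto_const_div_atTop_nhds_zero_nat (t - s))
    refine tendsto_of_tendsto_of_tendsto_of_le_of_le' tendsto_const_nhds h1 ?_ ?_
    · filter_upwards [eventually_ne_atTop 0] with N hN using le_cellEnd h hN u
    · filter_upwards [eventually_ne_atTop 0] with N hN using cellEnd_le h hN u
  · filter_upwards [eventually_ne_atTop 0] with N hN using le_cellEnd h hN u

lemma cellEnd_le_right {s t : ℝ} (h : s < t) {N : ℕ} (hN : N ≠ 0) {u : ℝ} (hu : u ∈ Set.Ioc s t) :
    cellEnd s t N u ≤ t := by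
  have hh : 0 < (t - s) / N := div_pos (sub_pos.2 h) (by positivity)
  have h1 : ⌈(u - s) / ((t - s) / N)⌉ ≤ (N : ℤ) := by
    rw [Int.ceil_le, div_le_iff₀ hh]
    have : (N : ℝ) ≠ 0 := Nat.cast_ne_zero.2 hN
    have h2 : ((N : ℤ) : ℝ) * ((t - s) / N) = t - s := by push_cast; field_simp
    rw [h2]; linarith [hu.2]
  have h3 : (⌈(u - s) / ((t - s) / N)⌉ : ℝ) ≤ N := by exact_mod_cast h1
  have h4 := mul_le_mul_of_nonneg_right h3 hh.le
  have h5 := gridPt_self s t hN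
  rw [gridPt] at h5
  rw [cellEnd]; linarith

lemma measurable_comp_cellEnd {E : Type*} [MeasurableSpace E] (x : ℝ → E) (s t : ℝ) (N : ℕ) :
    Measurable fun u => x (cellEnd s t N u) := by
  have h1 : Measurable fun k : ℤ => x (s + k * ((t - s) / N)) := measurable_from_top
  exact h1.comp (Int.measurable_ceil.comp (by fun_prop))

lemma SolvesPath.intervalIntegrable_cellEnd (hx : SolvesPath T e x l) {s t : ℝ} (h : s < t)
    {N : ℕ} (hN : N ≠ 0) {i : ℕ} :
    IntervalIntegrable (fun u => ‖x u - x (cellEnd s t N u)‖) volume (gridPt s t N i)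
      (gridPt s t N (i + 1)) := by
  have hle := gridPt_mono h.le N (Nat.le_succ i)
  refine IntervalIntegrable.congr (f := fun u => ‖x u - x (gridPt s t N (i + 1))‖) ?_
    ((hx.integrable _ _).sub intervalIntegrable_const).norm
  intro u hu
  rw [Set.uIoc_of_le hle] at hu
  simp only [cellEnd_eq h hN hu]

variable [CompleteSpace V]

/-- One step of the variation of constants: over `[v, w]` the change of the path, transported back
along the flow, differs from the noise increment by at most the oscillation of the path and the
first-order Taylor remainder of the flow. -/
lemma SolvesPath.norm_step_le (hx : SolvesPath T e x l) {v w : ℝ} (hvw : v ≤ w) :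
    ‖expFlow T (v - w) (x w) - x v - ((l w - l v : ℝ) : ℂ) • e‖ ≤
      ‖T‖ * (∫ u in v..w, ‖x u - x w‖) +
        ‖expFlow T (-(w - v)) - 1 - (-(w - v)) • (T * expFlow T 0)‖ * ‖x w‖ := by
  have h1 : expFlow T (v - w) (x w) - x v - ((l w - l v : ℝ) : ℂ) • e =
      T (∫ u in v..w, (x u - x w)) +
        (expFlow T (-(w - v)) - 1 - (-(w - v)) • (T * expFlow T 0)) (x w) := by
    -- the state equation expresses the noise increment through the path
    have h2 : ((l w - l v : ℝ) : ℂ) • e = x w - x v - ∫ u in v..w, T (x u) := by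
      rw [hx.equation v w hvw]; abel
    rw [h2, intervalIntegral.integral_sub (hx.integrable _ _) intervalIntegrable_const,
      intervalIntegral.integral_const, map_sub, T.intervalIntegral_comp_comm (hx.integrable _ _)]
    simp [expFlow_zero]
    module
  rw [h1]
  refine (norm_add_le _ _).trans (add_le_add ?_ (ContinuousLinearMap.le_opNorm _ _))
  refine (T.le_opNorm _).trans (mul_le_mul_of_nonneg_left ?_ (norm_nonneg _))
  exact intervalIntegral.norm_integral_le_integral_norm hvw

variable [MeasurableSpace V] [BorelSpace V] [SecondCountableTopology V]

lemma SolvesPath.tendsto_integral_cellEnd (hx : SolvesPath T e x l) {s t : ℝ} (h : s < t) :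
    Tendsto (fun N => ∫ u in s..t, ‖x u - x (cellEnd s t N u)‖) atTop (𝓝 0) := by
  obtain ⟨B, hB⟩ := hx.exists_bound s t
  have h0 : (∫ u in s..t, ‖x u - x u‖) = 0 := by simp
  rw [← h0]
  refine intervalIntegral.tendsto_integral_filter_of_dominated_convergence (fun _ => B + B)
    ?_ ?_ ?_ ?_
  · refine Eventually.of_forall fun N => ?_
    rw [Set.uIoc_of_le h.le]
    exact ((hx.integrable s t).1.aestronglyMeasurable.sub
      (measurable_comp_cellEnd x s t N).aestronglyMeasurable).norm
  · filter_upwards [eventually_ne_atTop 0] with N hN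
    refine Eventually.of_forall fun u hu => ?_
    rw [Set.uIoc_of_le h.le] at hu
    rw [norm_norm]
    refine (norm_sub_le _ _).trans (add_le_add (hB u ⟨hu.1.le, hu.2⟩) (hB _ ⟨?_, ?_⟩))
    · exact hu.1.le.trans (le_cellEnd h hN u)
    · exact cellEnd_le_right h hN hu
  · exact intervalIntegrable_const
  · refine Eventually.of_forall fun u _ => ?_
    exact ((tendsto_const_nhds.sub ((hx.continuousWithinAt u).tendsto.comp
      (tendsto_cellEnd h u))).norm)

/-- Variation of constants for a càdlàg driving path: the part of `x t` that is not explained by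
`x s` is the limit of the step sums of `e^{(t - u) T} e` against `l`. Right end points are used to
freeze the path, so right continuity suffices for the convergence. -/
theorem SolvesPath.tendsto_sum (hx : SolvesPath T e x l) {s t : ℝ} (h : s < t) :
    Tendsto (fun N => ∑ i ∈ Finset.range N,
      ((l (gridPt s t N (i + 1)) - l (gridPt s t N i) : ℝ) : ℂ) •
        expFlow T (t - gridPt s t N i) e) atTop (𝓝 (x t - expFlow T (t - s) (x s))) := by
  obtain ⟨B, hB⟩ := hx.exists_bound s t
  obtain ⟨C, hC⟩ := (isCompact_Icc (a := (0 : ℝ)) (b := t - s)).exists_bound_of_continuousOn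
    (continuous_expFlow T).continuousOn
  have hC0 : 0 ≤ C := (norm_nonneg _).trans (hC 0 ⟨le_rfl, sub_nonneg.2 h.le⟩)
  set rem : ℝ → ℝ := fun r => ‖expFlow T (-r) - 1 - (-r) • (T * expFlow T 0)‖ with hrem
  have hremlim : Tendsto (fun N : ℕ => N * rem ((t - s) / N)) atTop (𝓝 0) := by
    have h1 := (hasDerivAt_iff_isLittleO_nhds_zero.1 (hasDerivAt_expFlow T 0))
    have h2 : Tendsto (fun N : ℕ => -((t - s) / N)) atTop (𝓝 0) := by
      simpa using (tendsto_const_div_atTop_nhds_zero_nat (t - s)).neg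
    have h3 := (h1.comp_tendsto h2).norm_norm.tendsto_div_nhds_zero.mul_const (t - s)
    rw [zero_mul] at h3
    refine h3.congr' ?_
    filter_upwards [eventually_ne_atTop 0] with N hN
    have hN' : (0 : ℝ) < N := by positivity
    have hts := sub_pos.2 h
    simp only [Function.comp_apply, zero_add, expFlow_zero, norm_neg, Real.norm_eq_abs,
      abs_of_pos (div_pos hts hN'), hrem]
    field_simp
  have hlim := ((hx.tendsto_integral_cellEnd h).const_mul (C * ‖T‖)).add
    (hremlim.const_mul (C * B))
  simp only [mul_zero, add_zero] at hlim
  rw [tendsto_iff_norm_sub_tendsto_zero]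
  refine squeeze_zero' (Eventually.of_forall fun N => norm_nonneg _) ?_ hlim
  filter_upwards [eventually_ne_atTop 0] with N hN
  have hN' : (0 : ℝ) < N := by positivity
  have htel : x t - expFlow T (t - s) (x s) = ∑ i ∈ Finset.range N,
      (expFlow T (t - gridPt s t N (i + 1)) (x (gridPt s t N (i + 1))) -
        expFlow T (t - gridPt s t N i) (x (gridPt s t N i))) := by
    rw [Finset.sum_range_sub (fun i => expFlow T (t - gridPt s t N i) (x (gridPt s t N i))),
      gridPt_self s t hN, gridPt_zero, sub_self, expFlow_zero]
    rfl
  rw [norm_sub_rev, htel, ← Finset.sum_sub_distrib]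
  have hint : (∫ u in s..t, ‖x u - x (cellEnd s t N u)‖) = ∑ i ∈ Finset.range N,
      ∫ u in (gridPt s t N i)..(gridPt s t N (i + 1)), ‖x u - x (gridPt s t N (i + 1))‖ := by
    have := intervalIntegral.sum_integral_adjacent_intervals (μ := volume) (n := N)
      (a := gridPt s t N) (f := fun u => ‖x u - x (cellEnd s t N u)‖)
      (fun i _ => hx.intervalIntegrable_cellEnd h hN)
    rw [gridPt_self s t hN, gridPt_zero] at this
    rw [← this]
    refine Finset.sum_congr rfl fun i _ => intervalIntegral.integral_congr_ae ?_
    refine Eventually.of_forall fun u hu => ?_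
    rw [Set.uIoc_of_le (gridPt_mono h.le N (Nat.le_succ i))] at hu
    simp only [cellEnd_eq h hN hu]
  have hsum : C * ‖T‖ * (∫ u in s..t, ‖x u - x (cellEnd s t N u)‖) +
      C * B * (N * rem ((t - s) / N)) = ∑ i ∈ Finset.range N, C * (‖T‖ *
        (∫ u in (gridPt s t N i)..(gridPt s t N (i + 1)), ‖x u - x (gridPt s t N (i + 1))‖) +
          rem ((t - s) / N) * B) := by
    rw [hint, ← Finset.mul_sum, Finset.sum_add_distrib, ← Finset.mul_sum, Finset.sum_const,
      Finset.card_range, nsmul_eq_mul]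
    ring
  rw [hsum]
  refine norm_sum_le_of_le _ fun i hi => ?_
  have hi' : i < N := Finset.mem_range.1 hi
  have hm := gridPt_mem_Icc h.le hi'.le
  have hm' := gridPt_mem_Icc h.le (N := N) (i := i + 1) hi'
  have hd : gridPt s t N (i + 1) - gridPt s t N i = (t - s) / N := by
    rw [gridPt_succ]; ring
  have hfac : expFlow T (t - gridPt s t N (i + 1)) (x (gridPt s t N (i + 1))) -
        expFlow T (t - gridPt s t N i) (x (gridPt s t N i)) -
      ((l (gridPt s t N (i + 1)) - l (gridPt s t N i) : ℝ) : ℂ) •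
        expFlow T (t - gridPt s t N i) e =
      expFlow T (t - gridPt s t N i) (expFlow T (gridPt s t N i - gridPt s t N (i + 1))
        (x (gridPt s t N (i + 1))) - x (gridPt s t N i) -
          ((l (gridPt s t N (i + 1)) - l (gridPt s t N i) : ℝ) : ℂ) • e) := by
    rw [map_sub, map_sub, map_smul, ← mul_apply_eq_comp, ← expFlow_add]
    congr 4
    ring_nf
  rw [hfac]
  refine (ContinuousLinearMap.le_opNorm _ _).trans (mul_le_mul (hC _ ⟨?_, ?_⟩) ?_
    (norm_nonneg _) hC0)
  · linarith [hm.2]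
  · linarith [hm.1]
  · refine (hx.norm_step_le (gridPt_mono h.le N (Nat.le_succ i))).trans
      (add_le_add le_rfl ?_)
    rw [Nat.succ_eq_add_one, hd]
    exact mul_le_mul_of_nonneg_left (hB _ hm') (norm_nonneg _)

end Path

/-! ### The complexified state equation -/

/-- The operator of the state matrix on `ℂ ^ p`. -/
noncomputable def stateOp (p : ℕ) (a : Polynomial ℝ) : (Fin p → ℂ) →L[ℂ] (Fin p → ℂ) :=
  LinearMap.toContinuousLinearMap (Matrix.toLin' ((stateMatrix p a).map (algebraMap ℝ ℂ)))

/-- The last unit vector of `ℂ ^ p`. -/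
noncomputable def lastVec (p : ℕ) : Fin p → ℂ := fun i => (lastUnit p i : ℂ)

/-- The observation functional `v ↦ b_0 v_0 + ⋯ + b_{p-1} v_{p-1}` on `ℂ ^ p`. -/
noncomputable def obsFun (p : ℕ) (b : Polynomial ℝ) : (Fin p → ℂ) →L[ℂ] ℂ :=
  ∑ j : Fin p, (b.coeff (j : ℕ) : ℂ) • ContinuousLinearMap.proj j

lemma obsFun_apply (p : ℕ) (b : Polynomial ℝ) (v : Fin p → ℂ) :
    obsFun p b v = ∑ j : Fin p, (b.coeff (j : ℕ) : ℂ) * v j := by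
  simp [obsFun]

variable {p : ℕ} {a : Polynomial ℝ}

lemma stateOp_apply (v : Fin p → ℂ) (i : Fin p) :
    stateOp p a v i = ∑ j : Fin p, ((stateMatrix p a i j : ℝ) : ℂ) * v j := by
  simp [stateOp, Matrix.mulVec, dotProduct]

lemma stateOp_apply_of_lt (v : Fin p → ℂ) (i : ℕ) (hi : i + 1 < p) :
    stateOp p a v ⟨i, by omega⟩ = v ⟨i + 1, hi⟩ := by
  rw [stateOp_apply, Finset.sum_eq_single ⟨i + 1, hi⟩]
  · simp [stateMatrix, hi.ne]
  · intro j _ hj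
    have : (j : ℕ) ≠ i + 1 := fun h => hj (Fin.ext h)
    simp [stateMatrix, hi.ne, this]
  · simp

lemma stateOp_apply_last (v : Fin p → ℂ) (i : Fin p) (hi : (i : ℕ) + 1 = p) :
    stateOp p a v i = -∑ j : Fin p, (a.coeff (j : ℕ) : ℂ) * v j := by
  rw [stateOp_apply, ← Finset.sum_neg_distrib]
  refine Finset.sum_congr rfl fun j _ => ?_
  simp [stateMatrix, hi]

lemma stateOp_pow_apply (k : ℕ) (v : Fin p → ℂ) (i : ℕ) (hi : i + k < p) :
    (stateOp p a ^ k) v ⟨i, by omega⟩ = v ⟨i + k, hi⟩ := by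
  induction k generalizing v with
  | zero => rfl
  | succ k ih =>
    rw [pow_succ, mul_apply_eq_comp, ih _ (by omega), stateOp_apply_of_lt _ _ (by omega)]
    rfl

lemma commute_aeval {A : Type*} [Ring A] [Algebra ℂ A] {x y : A} (h : Commute x y)
    (P : Polynomial ℂ) : Commute (Polynomial.aeval x P) y := by
  rw [Polynomial.aeval_eq_sum_range]
  exact Commute.sum_left _ _ _ fun i _ => (h.pow_left i).smul_left _

/-- The companion operator satisfies its polynomial. As `(T ^ k v)_0 = v_k` for `k < p`, the
coordinate `0` of `a(T) v` vanishes for every `v`, and coordinate `i` of `a(T) v` is coordinate `0`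
of `a(T) T ^ i v`. -/
lemma aeval_stateOp (ha : a.Monic) (hp : a.natDegree = p) :
    Polynomial.aeval (stateOp p a) (a.map (algebraMap ℝ ℂ)) = 0 := by
  set T := stateOp p a with hT
  set A := Polynomial.aeval T (a.map (algebraMap ℝ ℂ)) with hA
  have hsum : A = ∑ k ∈ Finset.range (p + 1), (a.coeff k : ℂ) • T ^ k := by
    rw [hA, Polynomial.aeval_eq_sum_range' (n := p + 1)]
    · simp only [Polynomial.coeff_map, Complex.coe_algebraMap]
    · exact Nat.lt_succ_of_le (Polynomial.natDegree_map_le.trans hp.le)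
  have hcomm : ∀ k, A * T ^ k = T ^ k * A := fun k =>
    commute_aeval ((Commute.refl T).pow_right k) _
  have h0 : ∀ (v : Fin p → ℂ) (h : 0 < p), A v ⟨0, h⟩ = 0 := by
    intro v h
    rw [hsum, Finset.sum_range_succ, _root_.add_apply, Pi.add_apply,
      _root_.sum_apply, Finset.sum_apply]
    have e1 : ∀ k ∈ Finset.range p, ((a.coeff k : ℂ) • T ^ k) v ⟨0, h⟩ =
        if hk : k < p then (a.coeff k : ℂ) * v ⟨k, hk⟩ else 0 := by
      intro k hk
      have hk' := Finset.mem_range.1 hk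
      rw [dif_pos hk', _root_.smul_apply, Pi.smul_apply,
        stateOp_pow_apply k v 0 (by omega)]
      simp
    have e2 : (T ^ p) v ⟨0, h⟩ = -∑ j : Fin p, (a.coeff (j : ℕ) : ℂ) * v j := by
      obtain ⟨r, rfl⟩ := Nat.exists_eq_succ_of_ne_zero h.ne'
      rw [pow_succ, mul_apply_eq_comp, stateOp_pow_apply r _ 0 (by omega),
        stateOp_apply_last]
      simp
    rw [Finset.sum_congr rfl e1, _root_.smul_apply, Pi.smul_apply, e2]
    have e3 : a.coeff p = 1 := by rw [← hp]; exact ha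
    rw [e3, Finset.sum_range]
    simp
  ext v i
  have h : 0 < p := by have := i.2; omega
  have e1 := stateOp_pow_apply (a := a) (i : ℕ) (A v) 0 (by have := i.2; omega)
  rw [← mul_apply_eq_comp, ← hT, ← hcomm, mul_apply_eq_comp, h0] at e1
  simpa using e1.symm

section Annihilation

variable {V : Type*} [NormedAddCommGroup V] [NormedSpace ℂ V] [CompleteSpace V]

/-- `1 - e^{lΔ} e^{-ΔT}` is divisible by `T - l`: by the fundamental theorem of calculus the
quotient is `∫_0^Δ e^{lr} e^{-rT} dr`. -/
lemma exists_one_sub_smul_expFlow_eq_mul (T : V →L[ℂ] V) (l : ℂ) (Δ : ℝ) :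
    ∃ D : V →L[ℂ] V, Commute T D ∧
      1 - Complex.exp (l * Δ) • expFlow T (-Δ) = (T - algebraMap ℂ _ l) * D := by
  set f : ℝ → (V →L[ℂ] V) := fun r => Complex.exp (l * r) • expFlow T (-r) with hf
  have hfc : Continuous f := by
    have := continuous_expFlow T
    fun_prop
  have hd : ∀ r, HasDerivAt f (-((T - algebraMap ℂ _ l) * f r)) r := by
    intro r
    have h1 : HasDerivAt (fun r : ℝ => Complex.exp (l * r)) (Complex.exp (l * r) * l) r := by
      have : HasDerivAt (fun r : ℝ => l * (r : ℂ)) l r := by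
        simpa using (Complex.ofRealCLM.hasDerivAt (x := r)).const_mul l
      exact this.cexp
    have h2 : HasDerivAt (fun r : ℝ => expFlow T (-r)) (-(T * expFlow T (-r))) r := by
      simpa using! (hasDerivAt_expFlow T (-r)).scomp r (hasDerivAt_neg r)
    refine (h1.smul h2).congr_deriv ?_
    simp only [hf, sub_mul, mul_smul_comm, Algebra.algebraMap_eq_smul_one, smul_mul_assoc, one_mul]
    module
  have hcomm : ∀ r, Commute T (f r) := fun r => (commute_expFlow T _).smul_right _
  refine ⟨∫ r in (0 : ℝ)..Δ, f r, ?_, ?_⟩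
  · have e1 := ((ContinuousLinearMap.mul ℝ (V →L[ℂ] V)) T).intervalIntegral_comp_comm
      (hfc.intervalIntegrable (μ := volume) 0 Δ)
    have e2 := ((ContinuousLinearMap.mul ℝ (V →L[ℂ] V)).flip T).intervalIntegral_comp_comm
      (hfc.intervalIntegrable (μ := volume) 0 Δ)
    simp only [ContinuousLinearMap.mul_apply', ContinuousLinearMap.flip_apply] at e1 e2
    rw [Commute, SemiconjBy, ← e1, ← e2]
    exact intervalIntegral.integral_congr fun r _ => hcomm r
  · have e1 := ((ContinuousLinearMap.mul ℝ (V →L[ℂ] V))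
      (T - algebraMap ℂ _ l)).intervalIntegral_comp_comm
      (hfc.intervalIntegrable (μ := volume) 0 Δ)
    have e2 := intervalIntegral.integral_eq_sub_of_hasDerivAt (fun r _ => hd r)
      ((continuous_const.mul hfc).neg.intervalIntegrable (μ := volume) 0 Δ)
    simp only [ContinuousLinearMap.mul_apply'] at e1
    rw [intervalIntegral.integral_neg] at e2
    rw [← e1, ← neg_neg (∫ r in (0 : ℝ)..Δ, (T - algebraMap ℂ _ l) * f r), e2]
    simp [hf, expFlow_zero]

lemma exists_aeval_prod_eq_mul (T : V →L[ℂ] V) (s : Multiset ℂ) (Δ : ℝ) :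
    ∃ D : V →L[ℂ] V, Commute T D ∧
      Polynomial.aeval (expFlow T (-Δ)) (s.map fun l =>
        1 - Polynomial.C (Complex.exp (l * (Δ : ℂ))) * Polynomial.X).prod =
      Polynomial.aeval T (s.map fun l => Polynomial.X - Polynomial.C l).prod * D := by
  induction s using Multiset.induction_on with
  | empty => exact ⟨1, Commute.one_right _, by simp⟩
  | cons l s ih =>
    obtain ⟨D, hD, hs⟩ := ih
    obtain ⟨D', hD', hl⟩ := exists_one_sub_smul_expFlow_eq_mul T l Δ
    refine ⟨D' * D, hD'.mul_right hD, ?_⟩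
    have hl' : Polynomial.aeval (expFlow T (-Δ))
        (1 - Polynomial.C (Complex.exp (l * (Δ : ℂ))) * Polynomial.X) =
        (T - algebraMap ℂ _ l) * D' := by
      rw [← hl, map_sub, map_mul, map_one, Polynomial.aeval_C, Polynomial.aeval_X,
        Algebra.algebraMap_eq_smul_one, smul_mul_assoc, one_mul]
    rw [Multiset.map_cons, Multiset.prod_cons, map_mul, hl', hs, Multiset.map_cons,
      Multiset.prod_cons, map_mul, map_sub, Polynomial.aeval_X, Polynomial.aeval_C]
    have hc := (commute_aeval hD' (s.map fun l => Polynomial.X - Polynomial.C l).prod).eq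
    simp only [mul_assoc]
    congr 1
    rw [← mul_assoc, ← mul_assoc, hc]

end Annihilation

lemma natDegree_filterPoly_le (hp : a.natDegree = p) (Δ : ℝ) : (filterPoly a Δ).natDegree ≤ p := by
  have h1 : (a.aroots ℂ).card ≤ p :=
    (Polynomial.card_roots' _).trans (Polynomial.natDegree_map_le.trans hp.le)
  have h2 : ∀ s : Multiset ℂ, ((s.map fun l =>
      1 - Polynomial.C (Complex.exp (l * (Δ : ℂ))) * Polynomial.X).prod).natDegree ≤ s.card := by
    intro s
    induction s using Multiset.induction_on with
    | empty => simp
    | cons l s ih =>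
      rw [Multiset.map_cons, Multiset.prod_cons, Multiset.card_cons]
      refine Polynomial.natDegree_mul_le.trans ?_
      have : (1 - Polynomial.C (Complex.exp (l * (Δ : ℂ))) * Polynomial.X :
        Polynomial ℂ).natDegree ≤ 1 := by compute_degree
      omega
  exact (h2 _).trans h1

/-- The filter `φ(B)` annihilates the solutions of the homogeneous state equation. -/
lemma sum_filterPoly_smul_expFlow_pow (ha : a.Monic) (hp : a.natDegree = p) (Δ : ℝ) :
    ∑ k ∈ Finset.range (p + 1), (filterPoly a Δ).coeff k • expFlow (stateOp p a) Δ ^ (p - k) = 0 := by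
  set T := stateOp p a with hT
  obtain ⟨D, -, hD⟩ := exists_aeval_prod_eq_mul T (a.aroots ℂ) Δ
  have hsplit : ((a.aroots ℂ).map fun l => Polynomial.X - Polynomial.C l).prod =
      a.map (algebraMap ℝ ℂ) :=
    ((IsAlgClosed.splits _).eq_prod_roots_of_monic (ha.map _)).symm
  rw [hsplit, aeval_stateOp ha hp, zero_mul] at hD
  change Polynomial.aeval _ (filterPoly a Δ) = 0 at hD
  rw [Polynomial.aeval_eq_sum_range' (n := p + 1)
    (Nat.lt_succ_of_le (natDegree_filterPoly_le hp Δ))] at hD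
  have hpow : ∀ j, expFlow T Δ ^ j * expFlow T (-Δ) ^ j = 1 := by
    intro j
    rw [← expFlow_nat_mul, ← expFlow_nat_mul, ← expFlow_add, mul_neg, add_neg_cancel, expFlow_zero]
  have h2 := congrArg (fun S => expFlow T Δ ^ p * S) hD
  simp only [mul_zero, Finset.mul_sum] at h2
  rw [← h2]
  refine Finset.sum_congr rfl fun k hk => ?_
  have hk' : k ≤ p := Nat.lt_succ_iff.1 (Finset.mem_range.1 hk)
  rw [mul_smul_comm]
  congr 1
  have h3 : expFlow T Δ ^ p = expFlow T Δ ^ (p - k) * expFlow T Δ ^ k := by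
    rw [← pow_add, Nat.sub_add_cancel hk']
  rw [h3, mul_assoc, hpow, mul_one]

/-- The impulse response `b e^{tT} e_p` and its derivatives `b T ^ k e^{tT} e_p`. -/
noncomputable def impulse (p : ℕ) (a b : Polynomial ℝ) (k : ℕ) (t : ℝ) : ℂ :=
  obsFun p b ((stateOp p a ^ k) (expFlow (stateOp p a) t (lastVec p)))

lemma hasDerivAt_impulse (p : ℕ) (a b : Polynomial ℝ) (k : ℕ) (t : ℝ) :
    HasDerivAt (impulse p a b k) (impulse p a b (k + 1) t) t := by
  have h1 := (hasDerivAt_expFlow (stateOp p a) t)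
  let Φ : ((Fin p → ℂ) →L[ℂ] (Fin p → ℂ)) →L[ℂ] ℂ :=
    (obsFun p b ∘L (stateOp p a ^ k)) ∘L (ContinuousLinearMap.apply ℂ _ (lastVec p))
  have h2 := (Φ.restrictScalars ℝ).hasFDerivAt.comp_hasDerivAt t h1
  have e : impulse p a b (k + 1) t = Φ (stateOp p a * expFlow (stateOp p a) t) := by
    simp [Φ, impulse, pow_succ]
  rw [e]
  exact h2

lemma continuous_impulse (p : ℕ) (a b : Polynomial ℝ) (k : ℕ) : Continuous (impulse p a b k) :=
  continuous_iff_continuousAt.2 fun t => (hasDerivAt_impulse p a b k t).continuousAt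

/-- The derivatives of order less than `p - q - 1` of the impulse response vanish at `0`, the one
of order `p - q - 1` equals `1`. -/
lemma impulse_zero {q : ℕ} {b : Polynomial ℝ} (hab : IsAdmissible p q a b) {k : ℕ}
    (hk : k + q < p) : impulse p a b k 0 = if k + q + 1 = p then 1 else 0 := by
  have hbq : b.coeff q = 1 := by
    have := hab.b_monic
    rwa [Polynomial.Monic, Polynomial.leadingCoeff, hab.b_degree] at this
  have e1 : ∀ j : Fin p, (b.coeff (j : ℕ) : ℂ) * (stateOp p a ^ k) (lastVec p) j =
      if (j : ℕ) + k + 1 = p then (b.coeff (j : ℕ) : ℂ) else 0 := by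
    intro j
    rcases lt_or_ge q (j : ℕ) with h | h
    · rw [Polynomial.coeff_eq_zero_of_natDegree_lt (by rw [hab.b_degree]; exact h)]
      simp
    · rw [stateOp_pow_apply k _ (j : ℕ) (by omega)]
      simp only [lastVec, lastUnit]
      split_ifs <;> simp
  rw [impulse, expFlow_zero, one_apply_eq_self, obsFun_apply,
    Finset.sum_congr rfl fun j _ => e1 j]
  split_ifs with h
  · rw [Finset.sum_eq_single ⟨q, by omega⟩]
    · rw [if_pos (by simp only; omega), hbq]; simp
    · intro j _ hj
      rw [if_neg]
      intro h'
      exact hj (Fin.ext (by simp only; omega))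
    · simp
  · refine Finset.sum_eq_zero fun j _ => ?_
    split_ifs with h'
    · rw [Polynomial.coeff_eq_zero_of_natDegree_lt (by rw [hab.b_degree]; omega)]
      simp
    · rfl

/-- Division of a smooth function with vanishing derivatives at `0` by a power of the variable;
`f k` is the `k`-th derivative. -/
lemma exists_eq_pow_mul (m : ℕ) : ∀ f : ℕ → ℝ → ℂ,
    (∀ k t, HasDerivAt (f k) (f (k + 1) t) t) → (∀ k < m, f k 0 = 0) →
    ∃ G : ℝ → ℂ, Continuous G ∧ G 0 = f m 0 / (m.factorial : ℂ) ∧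
      ∀ t, f 0 t = (t : ℂ) ^ m * G t := by
  induction m with
  | zero =>
    intro f hf _
    exact ⟨f 0, continuous_iff_continuousAt.2 fun t => (hf 0 t).continuousAt, by simp, by simp⟩
  | succ m ih =>
    intro f hf hz
    obtain ⟨G, hG, hG0, hfG⟩ := ih (fun k => f (k + 1)) (fun k t => hf (k + 1) t)
      (fun k hk => hz (k + 1) (by omega))
    refine ⟨fun t => ∫ r in (0 : ℝ)..1, (r : ℂ) ^ m * G (t * r), ?_, ?_, ?_⟩
    · refine intervalIntegral.continuous_parametric_intervalIntegral_of_continuous' ?_ 0 1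
      fun_prop
    · simp only [zero_mul, hG0]
      rw [intervalIntegral.integral_mul_const]
      have : (∫ r in (0 : ℝ)..1, (r : ℂ) ^ m) = 1 / ((m : ℂ) + 1) := by
        have h1 : ∀ r : ℝ, (r : ℂ) ^ m = ((r ^ m : ℝ) : ℂ) := fun r => by push_cast; rfl
        simp only [h1]
        rw [intervalIntegral.integral_ofReal, integral_pow]
        simp
      rw [this, Nat.factorial_succ]
      have h1 : (m : ℂ) + 1 ≠ 0 := by exact_mod_cast Nat.succ_ne_zero m
      have h2 : (m.factorial : ℂ) ≠ 0 := by exact_mod_cast m.factorial_ne_zero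
      push_cast
      field_simp
    · intro t
      have hc : Continuous (f 1) := continuous_iff_continuousAt.2 fun t => (hf 1 t).continuousAt
      have h1 := intervalIntegral.integral_eq_sub_of_hasDerivAt (fun r _ => hf 0 r)
        (hc.intervalIntegrable (μ := volume) 0 t)
      rw [hz 0 (by omega), sub_zero, zero_add] at h1
      have h2 := intervalIntegral.smul_integral_comp_mul_left (a := 0) (b := 1) (f 1) t
      rw [mul_zero, mul_one, h1] at h2
      rw [← h2, pow_succ, mul_assoc, ← intervalIntegral.integral_const_mul,
        ← intervalIntegral.integral_const_mul, Complex.real_smul,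
        ← intervalIntegral.integral_const_mul]
      refine intervalIntegral.integral_congr fun r _ => ?_
      simp only [hfG]
      push_cast
      ring

/-! ### Finite moving sums and their spectral densities -/

section MovingSum

variable {Ω : Type*} [MeasurableSpace Ω] {μ : Measure Ω}

/-- The sequence `U` is a moving sum `U_n = ∑_{i < p} W_{n-i,i}` of centred square integrable
vectors `(W_{m,i})_i` that are uncorrelated for different `m` and have the same covariance
matrix `Q`. -/
structure IsMovingSum (μ : Measure Ω) (p : ℕ) (Q : ℕ → ℕ → ℂ) (W : ℤ → ℕ → Ω → ℂ)
    (U : ℤ → Ω → ℂ) : Prop where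
  memLp : ∀ m i, MemLp (W m i) 2 μ
  mean : ∀ m i, ∫ x, W m i x ∂μ = 0
  cov : ∀ m i m' i', ∫ x, W m i x * (starRingEnd ℂ) (W m' i' x) ∂μ = if m = m' then Q i i' else 0
  eq : ∀ n, U n =ᵐ[μ] fun x => ∑ i ∈ Finset.range p, W (n - i) i x

variable {p : ℕ} {Q : ℕ → ℕ → ℂ} {W : ℤ → ℕ → Ω → ℂ} {U : ℤ → Ω → ℂ}

lemma IsMovingSum.memLp_apply (h : IsMovingSum μ p Q W U) (n : ℤ) : MemLp (U n) 2 μ :=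
  (memLp_congr_ae (h.eq n)).2 (memLp_finsetSum _ fun _ _ => h.memLp _ _)

lemma IsMovingSum.integral_eq_zero [IsProbabilityMeasure μ] (h : IsMovingSum μ p Q W U) (n : ℤ) :
    ∫ x, U n x ∂μ = 0 := by
  rw [integral_congr_ae (h.eq n),
    integral_finsetSum _ fun i _ => (h.memLp _ _).integrable (by norm_num)]
  simp [h.mean]

lemma IsMovingSum.covar_eq [IsProbabilityMeasure μ] (h : IsMovingSum μ p Q W U) (n k : ℤ) :
    covar μ (U (n + k)) (U n) = ∑ i ∈ Finset.range p, ∑ j ∈ Finset.range p,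
      if k = (i : ℤ) - j then Q i j else 0 := by
  have hint : ∀ m i m' i', Integrable (fun x => W m i x * (starRingEnd ℂ) (W m' i' x)) μ :=
    fun m i m' i' => (h.memLp m i).integrable_mul (h.memLp m' i').star
  simp only [covar, h.integral_eq_zero, sub_zero]
  have e : ∀ᵐ x ∂μ, U (n + k) x * (starRingEnd ℂ) (U n x) = ∑ i ∈ Finset.range p,
      ∑ j ∈ Finset.range p, W (n + k - i) i x * (starRingEnd ℂ) (W (n - j) j x) := by
    filter_upwards [h.eq (n + k), h.eq n] with x h1 h2
    rw [h1, h2, map_sum, Finset.sum_mul_sum]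
  rw [integral_congr_ae e, integral_finsetSum _ fun i _ => integrable_finsetSum _ fun j _ =>
    hint _ _ _ _]
  refine Finset.sum_congr rfl fun i _ => ?_
  rw [integral_finsetSum _ fun j _ => hint _ _ _ _]
  refine Finset.sum_congr rfl fun j _ => ?_
  rw [h.cov]
  exact if_congr (by constructor <;> intro _ <;> omega) rfl rfl

lemma IsMovingSum.autocov_eq [IsProbabilityMeasure μ] (h : IsMovingSum μ p Q W U) (k : ℤ) :
    autocov μ U k = ∑ i ∈ Finset.range p, ∑ j ∈ Finset.range p,
      if k = (i : ℤ) - j then Q i j else 0 := by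
  have := h.covar_eq 0 k
  rwa [zero_add] at this

lemma IsMovingSum.isWeaklyStationary [IsProbabilityMeasure μ] (h : IsMovingSum μ p Q W U) :
    IsWeaklyStationary μ U where
  memLp := h.memLp_apply
  mean n := by rw [h.integral_eq_zero, h.integral_eq_zero]
  covar n k := by rw [h.covar_eq, ← h.autocov_eq, autocov]

lemma IsMovingSum.hasSum_autocov_mul [IsProbabilityMeasure μ] (h : IsMovingSum μ p Q W U)
    (f : ℤ → ℂ) : HasSum (fun k => autocov μ U k * f k)
      (∑ i ∈ Finset.range p, ∑ j ∈ Finset.range p, Q i j * f ((i : ℤ) - j)) := by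
  have e : (fun k => autocov μ U k * f k) = fun k => ∑ i ∈ Finset.range p, ∑ j ∈ Finset.range p,
      if k = (i : ℤ) - j then Q i j * f ((i : ℤ) - j) else 0 := by
    funext k
    rw [h.autocov_eq, Finset.sum_mul]
    refine Finset.sum_congr rfl fun i _ => ?_
    rw [Finset.sum_mul]
    refine Finset.sum_congr rfl fun j _ => ?_
    split_ifs with hk
    · rw [hk]
    · rw [zero_mul]
  rw [e]
  exact hasSum_sum fun i _ => hasSum_sum fun j _ => hasSum_ite_eq _ _

lemma IsMovingSum.summable_autocov [IsProbabilityMeasure μ] (h : IsMovingSum μ p Q W U) :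
    Summable (autocov μ U) := by
  simpa using (h.hasSum_autocov_mul fun _ => 1).summable

lemma integral_exp_int_mul (n : ℤ) :
    (∫ w in (-Real.pi)..Real.pi, Complex.exp (Complex.I * (n : ℂ) * (w : ℂ))) =
      if n = 0 then 2 * (Real.pi : ℂ) else 0 := by
  split_ifs with hn
  · simp [hn]; ring
  · have hc : Complex.I * (n : ℂ) ≠ 0 :=
      mul_ne_zero Complex.I_ne_zero (Int.cast_ne_zero.2 hn)
    rw [integral_exp_mul_complex hc]
    have : Complex.exp (Complex.I * n * (Real.pi : ℂ)) =
        Complex.exp (Complex.I * n * ((-Real.pi : ℝ) : ℂ)) := by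
      rw [Complex.exp_eq_exp_iff_exists_int]
      exact ⟨n, by push_cast; ring⟩
    rw [this, sub_self, zero_div]

/-- The spectral density of a moving sum, when the covariance matrix is the Gram matrix of
functions `g_i` in `L²(0, Δ)`, is the squared norm of the trigonometric polynomial with
coefficients `g_i`. -/
lemma sum_gram_mul_exp {Δ c : ℝ} {g : ℕ → ℝ → ℂ} (hg : ∀ i, Continuous (g i))
    (hQ : ∀ i j, Q i j = (c : ℂ) * ∫ r in (0 : ℝ)..Δ, g i r * (starRingEnd ℂ) (g j r)) (w : ℝ) :
    ∑ i ∈ Finset.range p, ∑ j ∈ Finset.range p,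
        Q i j * Complex.exp (-(Complex.I * (((i : ℤ) - (j : ℤ) : ℤ) : ℂ) * (w : ℂ))) =
      ((c * ∫ r in (0 : ℝ)..Δ, ‖∑ i ∈ Finset.range p,
        Complex.exp (-(Complex.I * (w : ℂ))) ^ i * g i r‖ ^ 2 : ℝ) : ℂ) := by
  have hconj : (starRingEnd ℂ) (Complex.exp (-(Complex.I * (w : ℂ)))) =
      Complex.exp (Complex.I * (w : ℂ)) := by
    rw [← Complex.exp_conj]; simp
  have e1 : ∀ i j : ℕ, Complex.exp (-(Complex.I * (((i : ℤ) - (j : ℤ) : ℤ) : ℂ) * (w : ℂ))) =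
      Complex.exp (-(Complex.I * (w : ℂ))) ^ i * Complex.exp (Complex.I * (w : ℂ)) ^ j := by
    intro i j
    rw [← Complex.exp_nat_mul, ← Complex.exp_nat_mul, ← Complex.exp_add]
    congr 1; push_cast; ring
  have hcont : ∀ i j, Continuous fun r => Complex.exp (-(Complex.I * (w : ℂ))) ^ i * g i r *
      (Complex.exp (Complex.I * (w : ℂ)) ^ j * (starRingEnd ℂ) (g j r)) := fun i j =>
    (continuous_const.mul (hg i)).mul (continuous_const.mul (Complex.continuous_conj.comp (hg j)))
  have e2 : ∀ r : ℝ, ((‖∑ i ∈ Finset.range p,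
      Complex.exp (-(Complex.I * (w : ℂ))) ^ i * g i r‖ ^ 2 : ℝ) : ℂ) =
      ∑ i ∈ Finset.range p, ∑ j ∈ Finset.range p,
        Complex.exp (-(Complex.I * (w : ℂ))) ^ i * g i r *
          (Complex.exp (Complex.I * (w : ℂ)) ^ j * (starRingEnd ℂ) (g j r)) := by
    intro r
    rw [Complex.ofReal_pow, ← Complex.mul_conj', map_sum, Finset.sum_mul_sum]
    simp only [map_mul, map_pow, hconj]
  rw [Complex.ofReal_mul, ← intervalIntegral.integral_ofReal]
  simp only [e2]
  rw [intervalIntegral.integral_finsetSum fun i _ => ?_]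
  · rw [Finset.mul_sum]
    refine Finset.sum_congr rfl fun i _ => ?_
    rw [intervalIntegral.integral_finsetSum fun j _ => (hcont i j).intervalIntegrable _ _,
      Finset.mul_sum]
    refine Finset.sum_congr rfl fun j _ => ?_
    rw [hQ, e1, mul_assoc, mul_comm (∫ r in (0 : ℝ)..Δ, g i r * (starRingEnd ℂ) (g j r)),
      ← intervalIntegral.integral_const_mul]
    congr 1
    refine intervalIntegral.integral_congr fun r _ => ?_
    ring
  · exact (continuous_finsetSum _ fun j _ => hcont i j).intervalIntegrable _ _

variable [IsProbabilityMeasure μ] {Δ c : ℝ} {g : ℕ → ℝ → ℂ}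

lemma IsMovingSum.tsum_autocov_mul_exp (h : IsMovingSum μ p Q W U) (hg : ∀ i, Continuous (g i))
    (hQ : ∀ i j, Q i j = (c : ℂ) * ∫ r in (0 : ℝ)..Δ, g i r * (starRingEnd ℂ) (g j r)) (w : ℝ) :
    ∑' k : ℤ, autocov μ U k * Complex.exp (-(Complex.I * (k : ℂ) * (w : ℂ))) =
      ((c * ∫ r in (0 : ℝ)..Δ, ‖∑ i ∈ Finset.range p,
        Complex.exp (-(Complex.I * (w : ℂ))) ^ i * g i r‖ ^ 2 : ℝ) : ℂ) := by
  rw [← sum_gram_mul_exp hg hQ]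
  exact (h.hasSum_autocov_mul fun k => Complex.exp (-(Complex.I * (k : ℂ) * (w : ℂ)))).tsum_eq

lemma IsMovingSum.spectralDensity_eq (h : IsMovingSum μ p Q W U) (hg : ∀ i, Continuous (g i))
    (hQ : ∀ i j, Q i j = (c : ℂ) * ∫ r in (0 : ℝ)..Δ, g i r * (starRingEnd ℂ) (g j r)) (w : ℝ) :
    spectralDensity μ U w = 1 / (2 * Real.pi) * (c * ∫ r in (0 : ℝ)..Δ,
      ‖∑ i ∈ Finset.range p, Complex.exp (-(Complex.I * (w : ℂ))) ^ i * g i r‖ ^ 2) := by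
  rw [spectralDensity, h.tsum_autocov_mul_exp hg hQ, Complex.ofReal_re]

lemma IsMovingSum.isSpectralDensity (h : IsMovingSum μ p Q W U) (hg : ∀ i, Continuous (g i))
    (hQ : ∀ i j, Q i j = (c : ℂ) * ∫ r in (0 : ℝ)..Δ, g i r * (starRingEnd ℂ) (g j r))
    (hc : 0 ≤ c) (hΔ : 0 ≤ Δ) : IsSpectralDensity μ U (spectralDensity μ U) := by
  have hf : ∀ w, (spectralDensity μ U w : ℂ) = 1 / (2 * (Real.pi : ℂ)) *
      ∑ i ∈ Finset.range p, ∑ j ∈ Finset.range p,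
        Q i j * Complex.exp (-(Complex.I * (((i : ℤ) - (j : ℤ) : ℤ) : ℂ) * (w : ℂ))) := by
    intro w
    rw [sum_gram_mul_exp hg hQ, h.spectralDensity_eq hg hQ]
    push_cast; rfl
  refine ⟨h.isWeaklyStationary, fun w _ => ?_, ?_, fun k => ?_⟩
  · rw [h.spectralDensity_eq hg hQ]
    exact mul_nonneg (by positivity) (mul_nonneg hc
      (intervalIntegral.integral_nonneg hΔ fun r _ => by positivity))
  · have : Continuous (spectralDensity μ U) := by
      have h1 : spectralDensity μ U = fun w => (spectralDensity μ U w : ℂ).re := by simp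
      rw [h1]
      simp only [hf]
      fun_prop
    exact this.intervalIntegrable _ _
  · have hpi : (Real.pi : ℂ) ≠ 0 := by exact_mod_cast Real.pi_ne_zero
    have e : ∀ w : ℝ, Complex.exp (Complex.I * (k : ℂ) * (w : ℂ)) * (spectralDensity μ U w : ℂ) =
        ∑ i ∈ Finset.range p, ∑ j ∈ Finset.range p, 1 / (2 * (Real.pi : ℂ)) * Q i j *
          Complex.exp (Complex.I * ((k - ((i : ℤ) - j) : ℤ) : ℂ) * (w : ℂ)) := by
      intro w
      rw [hf, Finset.mul_sum, Finset.mul_sum]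
      refine Finset.sum_congr rfl fun i _ => ?_
      rw [Finset.mul_sum, Finset.mul_sum]
      refine Finset.sum_congr rfl fun j _ => ?_
      have : Complex.I * ((k - ((i : ℤ) - j) : ℤ) : ℂ) * (w : ℂ) = Complex.I * (k : ℂ) * (w : ℂ) +
          -(Complex.I * (((i : ℤ) - (j : ℤ) : ℤ) : ℂ) * (w : ℂ)) := by push_cast; ring
      rw [this, Complex.exp_add]
      ring
    have hcont : ∀ (z : ℂ) (n : ℤ), Continuous fun w : ℝ =>
        z * Complex.exp (Complex.I * (n : ℂ) * (w : ℂ)) := fun z n => by fun_prop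
    simp only [e]
    rw [h.autocov_eq, intervalIntegral.integral_finsetSum fun i _ => ?_]
    · refine Finset.sum_congr rfl fun i _ => ?_
      rw [intervalIntegral.integral_finsetSum fun j _ => (hcont _ _).intervalIntegrable _ _]
      refine Finset.sum_congr rfl fun j _ => ?_
      rw [intervalIntegral.integral_const_mul, integral_exp_int_mul]
      by_cases hk : k = (i : ℤ) - j
      · rw [if_pos hk, if_pos (sub_eq_zero.2 hk)]; field_simp
      · rw [if_neg hk, if_neg (sub_ne_zero.2 hk), mul_zero]
    · exact (continuous_finsetSum _ fun j _ => hcont _ _).intervalIntegrable _ _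

end MovingSum

/-! ### The filtered sample as a moving sum -/

section Recursion

variable {V : Type*} [NormedAddCommGroup V] [NormedSpace ℂ V]

lemma apply_add_eq_pow_add_sum (E : V →L[ℂ] V) (y : ℤ → V) (m : ℤ) (j : ℕ) :
    y (m + j) = (E ^ j) (y m) +
      ∑ i ∈ Finset.range j, (E ^ i) (y (m + j - i) - E (y (m + j - i - 1))) := by
  induction j with
  | zero => simp
  | succ j ih =>
    rw [Finset.sum_range_succ']
    have e1 : ∀ i : ℕ, (E ^ (i + 1)) (y (m + (j + 1 : ℕ) - (i + 1 : ℕ)) -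
        E (y (m + (j + 1 : ℕ) - (i + 1 : ℕ) - 1))) =
        E ((E ^ i) (y (m + j - i) - E (y (m + j - i - 1)))) := by
      intro i
      have : m + ((j + 1 : ℕ) : ℤ) - ((i + 1 : ℕ) : ℤ) = m + j - i := by push_cast; ring
      rw [this, pow_succ', mul_apply_eq_comp]
    simp only [e1]
    rw [← map_sum, ← add_assoc, pow_succ', mul_apply_eq_comp, ← map_add, ← ih]
    have e2 : m + ((j + 1 : ℕ) : ℤ) - ((0 : ℕ) : ℤ) - 1 = m + j := by push_cast; ring
    rw [e2]
    simp

/-- If the coefficients `φ_k` satisfy `∑_k φ_k E ^ (p - k) = 0` then the filter `φ(B)` removes the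
initial value from a solution of a recursion with matrix `E`, and only the innovations
`y_m - E y_{m-1}` of the last `p` steps remain. -/
lemma sum_smul_apply_sub (E : V →L[ℂ] V) (y : ℤ → V) (φ : ℕ → ℂ) (p : ℕ)
    (hφ : ∑ k ∈ Finset.range (p + 1), φ k • E ^ (p - k) = 0) (n : ℤ) :
    ∑ k ∈ Finset.range (p + 1), φ k • y (n - k) =
      ∑ i ∈ Finset.range p, ∑ k ∈ Finset.range (i + 1),
        φ k • (E ^ (i - k)) (y (n - i) - E (y (n - i - 1))) := by
  set R : ℤ → V := fun m => y m - E (y (m - 1)) with hR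
  have h1 : ∀ k ∈ Finset.range (p + 1), φ k • y (n - k) = (φ k • E ^ (p - k)) (y (n - p)) +
      ∑ i ∈ Finset.range (p - k), φ k • (E ^ i) (R (n - (k + i : ℕ))) := by
    intro k hk
    have hk' : k ≤ p := Nat.lt_succ_iff.1 (Finset.mem_range.1 hk)
    have e := apply_add_eq_pow_add_sum E y (n - p) (p - k)
    have e0 : n - (p : ℤ) + ((p - k : ℕ) : ℤ) = n - k := by omega
    rw [e0] at e
    rw [e, smul_add, Finset.smul_sum]
    refine congrArg₂ (· + ·) rfl (Finset.sum_congr rfl fun i _ => ?_)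
    have e2 : n - ((k + i : ℕ) : ℤ) = n - k - i := by omega
    rw [hR, e2]
  have h2 := Finset.sum_range_diag_flip p fun k i => φ k • (E ^ i) (R (n - (k + i : ℕ)))
  rw [Finset.sum_congr rfl h1, Finset.sum_add_distrib, ← sum_apply, hφ, zero_apply, zero_add,
    Finset.sum_range_succ, Nat.sub_self, Finset.range_zero, Finset.sum_empty, add_zero, ← h2]
  refine Finset.sum_congr rfl fun i _ => Finset.sum_congr rfl fun k hk => ?_
  have : k + (i - k) = i := by have := Finset.mem_range.1 hk; omega
  rw [this]

end Recursion

/-- The kernel of the `i`-th summand of the moving sum representation of the filtered sample. -/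
noncomputable def sampleKernel (p : ℕ) (a b : Polynomial ℝ) (Δ : ℝ) (i : ℕ) (r : ℝ) : ℂ :=
  ∑ k ∈ Finset.range (i + 1),
    (filterPoly a Δ).coeff k * impulse p a b 0 (r + ((i - k : ℕ) : ℝ) * Δ)

lemma continuous_sampleKernel (p : ℕ) (a b : Polynomial ℝ) (Δ : ℝ) (i : ℕ) :
    Continuous (sampleKernel p a b Δ i) := by
  have := continuous_impulse p a b 0
  unfold sampleKernel
  fun_prop

/-- The functional extracting the `i`-th summand of the moving sum representation of the filtered
sample from the innovation of the state. -/
noncomputable def sampleFun (p : ℕ) (a b : Polynomial ℝ) (Δ : ℝ) (i : ℕ) :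
    (Fin p → ℂ) →L[ℂ] ℂ :=
  ∑ k ∈ Finset.range (i + 1),
    (filterPoly a Δ).coeff k • (obsFun p b ∘L expFlow (stateOp p a) Δ ^ (i - k))

lemma sampleFun_expFlow (p : ℕ) (a b : Polynomial ℝ) (Δ : ℝ) (i : ℕ) (r : ℝ) :
    sampleFun p a b Δ i (expFlow (stateOp p a) r (lastVec p)) = sampleKernel p a b Δ i r := by
  rw [sampleFun, sampleKernel, sum_apply]
  refine Finset.sum_congr rfl fun k _ => ?_
  rw [smul_apply, ContinuousLinearMap.comp_apply, smul_eq_mul, impulse, pow_zero,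
    one_apply_eq_self, add_comm r, expFlow_add, expFlow_nat_mul, mul_apply_eq_comp]

section StateSpace

variable {Ω : Type*} [MeasurableSpace Ω] {μ : Measure Ω} {p : ℕ} {a b : Polynomial ℝ}
  {L : ℝ → Ω → ℝ} {X : ℝ → Ω → Fin p → ℝ}

/-- The inclusion of `ℝ ^ p` into `ℂ ^ p`. -/
noncomputable def complexify (p : ℕ) : (Fin p → ℝ) →L[ℝ] (Fin p → ℂ) :=
  ContinuousLinearMap.pi fun j => Complex.ofRealCLM ∘L ContinuousLinearMap.proj j

lemma complexify_apply (v : Fin p → ℝ) (j : Fin p) : complexify p v j = (v j : ℂ) := rfl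

lemma SolvesStateEquation.solvesPath (hL : IsLevyProcess μ L)
    (hX : SolvesStateEquation μ p a L X) :
    ∀ᵐ x ∂μ, SolvesPath (stateOp p a) (lastVec p) (fun t => complexify p (X t x))
      (fun t => L t x) := by
  filter_upwards [hL.cadlag, hX.integrable, hX.equation] with x h1 h2 h3
  refine ⟨h1, fun s t => ⟨(complexify p).integrable_comp (h2 s t).1,
    (complexify p).integrable_comp (h2 s t).2⟩, fun s t hst => ?_⟩
  have hint : IntervalIntegrable (fun u => (stateMatrix p a).mulVec (X u x)) volume s t :=
    ⟨(LinearMap.toContinuousLinearMap (stateMatrix p a).mulVecLin).integrable_comp (h2 s t).1,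
      (LinearMap.toContinuousLinearMap (stateMatrix p a).mulVecLin).integrable_comp (h2 s t).2⟩
  have e1 : ∀ v : Fin p → ℝ, complexify p ((stateMatrix p a).mulVec v) =
      stateOp p a (complexify p v) := by
    intro v
    ext i
    rw [complexify_apply, stateOp_apply]
    simp [Matrix.mulVec, dotProduct, complexify_apply]
  rw [← map_sub, h3 s t hst, map_add, ← ContinuousLinearMap.intervalIntegral_comp_comm _ hint]
  simp only [e1]
  congr 1
  ext i
  simp [complexify_apply, lastVec]

/-- The innovation of the sampled state, as seen by the functional `sampleFun`. -/
noncomputable def innovation (p : ℕ) (a b : Polynomial ℝ) (X : ℝ → Ω → Fin p → ℝ) (Δ : ℝ) (m : ℤ)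
    (i : ℕ) (x : Ω) : ℂ :=
  sampleFun p a b Δ i (complexify p (X (m * Δ) x) -
    expFlow (stateOp p a) Δ (complexify p (X ((m - 1 : ℤ) * Δ) x)))

lemma isStepLimit_innovation (hL : IsLevyProcess μ L) (hX : SolvesStateEquation μ p a L X)
    {Δ : ℝ} (hΔ : 0 < Δ) (m : ℤ) (i : ℕ) :
    IsStepLimit μ L (sampleKernel p a b Δ i) ((m - 1 : ℤ) * Δ) (m * Δ)
      (innovation p a b X Δ m i) := by
  filter_upwards [hX.solvesPath hL] with x hx
  have h1 : ((m - 1 : ℤ) : ℝ) * Δ < m * Δ := by push_cast; linarith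
  have h2 := ((sampleFun p a b Δ i).continuous.tendsto _).comp (hx.tendsto_sum h1)
  have h3 : (m : ℝ) * Δ - ((m - 1 : ℤ) : ℝ) * Δ = Δ := by push_cast; ring
  rw [h3] at h2
  refine h2.congr fun N => ?_
  simp only [Function.comp_apply, map_sum, map_smul, sampleFun_expFlow, stepSum, smul_eq_mul]
  exact Finset.sum_congr rfl fun j _ => mul_comm _ _

lemma filteredSample_eq (ha : a.Monic) (hp : a.natDegree = p) {Y : ℝ → Ω → ℝ}
    (hY : ∀ t, ∀ᵐ x ∂μ, Y t x = ∑ j : Fin p, b.coeff (j : ℕ) * X t x j) (Δ : ℝ) (n : ℤ) :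
    filteredSample a Y Δ n =ᵐ[μ] fun x =>
      ∑ i ∈ Finset.range p, innovation p a b X Δ (n - i) i x := by
  have hall : ∀ᵐ x ∂μ, ∀ k : ℕ, (sampled Y Δ (n - k) x) =
      obsFun p b (complexify p (X (((n - k : ℤ) : ℝ) * Δ) x)) := by
    refine ae_all_iff.2 fun k => ?_
    filter_upwards [hY (((n - k : ℤ) : ℝ) * Δ)] with x hx
    rw [sampled, hx, obsFun_apply]
    simp [complexify_apply]
  filter_upwards [hall] with x hx
  have e1 : filteredSample a Y Δ n x = ∑ k ∈ Finset.range (p + 1),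
      (filterPoly a Δ).coeff k * sampled Y Δ (n - (k : ℤ)) x := by
    rw [filteredSample, applyFilter]
    -- only the bound `p` on the degree of the filter polynomial matters: the additional
    -- coefficients vanish
    refine Finset.sum_subset (Finset.range_mono
      (Nat.succ_le_succ (natDegree_filterPoly_le hp Δ))) fun k _ hk => ?_
    rw [Polynomial.coeff_eq_zero_of_natDegree_lt, zero_mul]
    simpa [Nat.lt_succ_iff] using hk
  have e2 := congrArg (obsFun p b) (sum_smul_apply_sub (expFlow (stateOp p a) Δ)
    (fun m => complexify p (X ((m : ℝ) * Δ) x)) (filterPoly a Δ).coeff p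
    (sum_filterPoly_smul_expFlow_pow ha hp Δ) n)
  simp only [map_sum, map_smul, smul_eq_mul] at e2
  rw [e1]
  simp only [hx]
  rw [e2]
  refine Finset.sum_congr rfl fun i _ => ?_
  rw [innovation, sampleFun, sum_apply]
  rfl

/-- The filtered sample is a moving sum of the innovations of the sampled state; the covariance
matrix of the innovations is given by the isometry property. -/
lemma isMovingSum_filteredSample [IsProbabilityMeasure μ] {σ : ℝ} (hL : IsSecondOrderLevy μ L σ)
    (hX : SolvesStateEquation μ p a L X) (ha : a.Monic) (hp : a.natDegree = p) {Y : ℝ → Ω → ℝ}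
    (hY : ∀ t, ∀ᵐ x ∂μ, Y t x = ∑ j : Fin p, b.coeff (j : ℕ) * X t x j) {Δ : ℝ} (hΔ : 0 < Δ) :
    IsMovingSum μ p (fun i j => ((σ ^ 2 : ℝ) : ℂ) * ∫ r in (0 : ℝ)..Δ,
        sampleKernel p a b Δ i r * (starRingEnd ℂ) (sampleKernel p a b Δ j r))
      (innovation p a b X Δ) (filteredSample a Y Δ) := by
  have hlim := isStepLimit_innovation (b := b) hL.toIsLevyProcess hX hΔ
  have hk := continuous_sampleKernel p a b Δ
  have hle : ∀ m : ℤ, ((m - 1 : ℤ) : ℝ) * Δ ≤ m * Δ := fun m => by push_cast; linarith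
  refine ⟨fun m i => (hlim m i).memLp hL (hk i) (hle m),
    fun m i => (hlim m i).integral_eq_zero hL (hk i) (hle m), fun m i m' i' => ?_,
    filteredSample_eq ha hp hY Δ⟩
  split_ifs with h
  · subst h
    rw [(hlim m i).integral_mul_conj_same hL (hk i) (hk i') (hle m) (hlim m i')]
    have h3 : (m : ℝ) * Δ - ((m - 1 : ℤ) : ℝ) * Δ = Δ := by push_cast; ring
    rw [h3]
    push_cast; rfl
  · refine (hlim m i).integral_mul_conj_of_le hL (hk i) (hk i') (hle m) (hle m') (hlim m' i') ?_
    rcases lt_or_gt_of_ne h with h | h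
    · left
      have : (m : ℝ) ≤ ((m' - 1 : ℤ) : ℝ) := by exact_mod_cast (by omega : m ≤ m' - 1)
      exact mul_le_mul_of_nonneg_right this hΔ.le
    · right
      have : (m' : ℝ) ≤ ((m - 1 : ℤ) : ℝ) := by exact_mod_cast (by omega : m' ≤ m - 1)
      exact mul_le_mul_of_nonneg_right this hΔ.le

end StateSpace

/-! ### The limit of the spectral density -/

lemma continuous_coeff_prod (s : Multiset ℂ) (k : ℕ) : Continuous fun Δ : ℝ =>
    ((s.map fun l => 1 - Polynomial.C (Complex.exp (l * (Δ : ℂ))) * Polynomial.X).prod).coeff k := by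
  induction s using Multiset.induction_on generalizing k with
  | empty => simpa using continuous_const
  | cons l s ih =>
    simp only [Multiset.map_cons, Multiset.prod_cons, Polynomial.coeff_mul]
    refine continuous_finsetSum _ fun ij _ => Continuous.mul ?_ (ih _)
    simp only [Polynomial.coeff_sub, Polynomial.coeff_C_mul]
    fun_prop

lemma filterPoly_zero {p : ℕ} {a : Polynomial ℝ} (hp : a.natDegree = p) :
    filterPoly a 0 = (1 - Polynomial.X) ^ p := by
  have h : (a.aroots ℂ).card = p := by
    rw [← hp, ← Polynomial.natDegree_map (algebraMap ℝ ℂ)]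
    exact (IsAlgClosed.splits (a.map (algebraMap ℝ ℂ))).natDegree_eq_card_roots.symm
  simp [filterPoly, h]

/-- The trigonometric polynomial whose squared norm gives the spectral density, with time measured
in units of the sampling step and the leading power of the step removed. -/
noncomputable def scaledKernel (p : ℕ) (a : Polynomial ℝ) (m : ℕ) (G : ℝ → ℂ) (z : ℂ) (Δ x : ℝ) :
    ℂ :=
  ∑ i ∈ Finset.range p, z ^ i * ∑ k ∈ Finset.range (i + 1), (filterPoly a Δ).coeff k *
    (((x : ℂ) + ((i - k : ℕ) : ℂ)) ^ m * G (Δ * (x + ((i - k : ℕ) : ℝ))))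

lemma continuous_scaledKernel (p : ℕ) (a : Polynomial ℝ) (m : ℕ) {G : ℝ → ℂ} (hG : Continuous G)
    (z : ℂ) : Continuous fun q : ℝ × ℝ => scaledKernel p a m G z q.1 q.2 := by
  have h : ∀ k, Continuous fun Δ : ℝ => (filterPoly a Δ).coeff k := fun k =>
    continuous_coeff_prod _ k
  unfold scaledKernel
  refine continuous_finsetSum _ fun i _ => continuous_const.mul
    (continuous_finsetSum _ fun k _ => ((h k).comp continuous_fst).mul ?_)
  fun_prop

lemma sum_sampleKernel_eq {p m : ℕ} {a b : Polynomial ℝ} {G : ℝ → ℂ}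
    (hG : ∀ t, impulse p a b 0 t = (t : ℂ) ^ m * G t) (z : ℂ) (Δ x : ℝ) :
    ∑ i ∈ Finset.range p, z ^ i * sampleKernel p a b Δ i (Δ * x) =
      (Δ : ℂ) ^ m * scaledKernel p a m G z Δ x := by
  rw [scaledKernel, Finset.mul_sum]
  refine Finset.sum_congr rfl fun i _ => ?_
  rw [sampleKernel, mul_left_comm]
  congr 1
  rw [Finset.mul_sum]
  refine Finset.sum_congr rfl fun k _ => ?_
  have e : Δ * x + ((i - k : ℕ) : ℝ) * Δ = Δ * (x + ((i - k : ℕ) : ℝ)) := by ring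
  rw [e, hG, Complex.ofReal_mul, mul_pow]
  push_cast
  ring

/-- After the time change `r = Δ x` the spectral density is `Δ ^ (2 m + 1)` times an integral that
depends continuously on `Δ`, also at `Δ = 0`. -/
lemma simZero_of_integral_eq {p m : ℕ} {a b : Polynomial ℝ} {G : ℝ → ℂ} (hGc : Continuous G)
    (hG : ∀ t, impulse p a b 0 t = (t : ℂ) ^ m * G t) {z : ℂ} {f : ℝ → ℝ} {v c : ℝ} (hv : v ≠ 0)
    (hf : ∀ Δ, 0 < Δ → f Δ = 1 / (2 * Real.pi) * (v * ∫ r in (0 : ℝ)..Δ,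
      ‖∑ i ∈ Finset.range p, z ^ i * sampleKernel p a b Δ i r‖ ^ 2))
    (hc : ∫ x in (0 : ℝ)..1, ‖scaledKernel p a m G z 0 x‖ ^ 2 = c) (hc0 : c ≠ 0) :
    SimZero f (fun Δ => v * Δ ^ (2 * m + 1) / (2 * Real.pi) * c) := by
  set J : ℝ → ℝ := fun Δ => ∫ x in (0 : ℝ)..1, ‖scaledKernel p a m G z Δ x‖ ^ 2 with hJ
  have hJc : Continuous J := by
    refine intervalIntegral.continuous_parametric_intervalIntegral_of_continuous' ?_ 0 1
    exact (continuous_scaledKernel p a m hGc z).norm.pow 2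
  have hlim : Tendsto (fun Δ => J Δ / c) (𝓝[>] 0) (𝓝 1) := by
    have : Tendsto (fun Δ => J Δ / c) (𝓝 0) (𝓝 (J 0 / c)) :=
      (hJc.tendsto 0).div_const c
    rw [show J 0 = c from hc, div_self hc0] at this
    exact this.mono_left nhdsWithin_le_nhds
  refine hlim.congr' ?_
  filter_upwards [self_mem_nhdsWithin] with Δ hΔ
  have hΔ' : (0 : ℝ) < Δ := hΔ
  have h1 := intervalIntegral.smul_integral_comp_mul_left (a := 0) (b := 1)
    (fun r => ‖∑ i ∈ Finset.range p, z ^ i * sampleKernel p a b Δ i r‖ ^ 2) Δ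
  rw [mul_zero, mul_one] at h1
  simp only [sum_sampleKernel_eq hG, norm_mul, norm_pow, Complex.norm_real, Real.norm_eq_abs,
    abs_of_pos hΔ', mul_pow] at h1
  rw [intervalIntegral.integral_const_mul, smul_eq_mul] at h1
  rw [hf Δ hΔ', ← h1]
  change J Δ / c = 1 / (2 * Real.pi) * (v * (Δ * ((Δ ^ m) ^ 2 * J Δ))) / _
  have hpi := Real.pi_ne_zero
  field_simp
  ring

/-! ### Generating functions of powers of an arithmetic progression -/

section GeneratingFunction

open PowerSeries

lemma one_sub_X_mul_mk (s : ℕ → ℂ) :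
    (1 - X) * PowerSeries.mk s = C (s 0) + X * PowerSeries.mk fun n => s (n + 1) - s n := by
  ext n
  cases n with
  | zero => simp [sub_mul]
  | succ n => simp [sub_mul, coeff_succ_X_mul]

lemma one_sub_X_mul_mk_one : (1 - X) * PowerSeries.mk (fun _ => (1 : ℂ)) = 1 := by
  have : (PowerSeries.mk fun _ : ℕ => (1 : ℂ) - 1) = 0 := by ext; simp
  rw [one_sub_X_mul_mk, this]
  simp

lemma one_sub_X_sq_mul_mk (y : ℂ) :
    (1 - X) ^ 2 * PowerSeries.mk (fun n : ℕ => y + n) = C y * (1 - X) + X := by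
  have h : (PowerSeries.mk fun n : ℕ => y + ((n + 1 : ℕ) : ℂ) - (y + n)) =
      PowerSeries.mk fun _ => (1 : ℂ) := by ext; simp
  rw [pow_two, mul_assoc, one_sub_X_mul_mk, h, mul_add, mul_left_comm, one_sub_X_mul_mk_one]
  simp [mul_comm]

lemma one_sub_X_cube_mul_mk (y : ℂ) :
    (1 - X) ^ 3 * PowerSeries.mk (fun n : ℕ => (y + n) ^ 2) =
      C (y ^ 2) * (1 - X) ^ 2 + X * (C (2 * y + 1) * (1 - X) + C 2 * X) := by
  have h : (PowerSeries.mk fun n : ℕ => (y + ((n + 1 : ℕ) : ℂ)) ^ 2 - (y + n) ^ 2) =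
      C 2 * PowerSeries.mk fun n : ℕ => (y + 1 / 2) + n := by
    ext n; simp only [coeff_mk, coeff_C_mul]; push_cast; ring
  have e : (1 - X : PowerSeries ℂ) ^ 3 = (1 - X) ^ 2 * (1 - X) := by ring
  rw [e, mul_assoc, one_sub_X_mul_mk, h, mul_add, mul_left_comm _ X, mul_left_comm _ (C 2),
    one_sub_X_sq_mul_mk, mul_add (C 2), ← mul_assoc (C 2), ← map_mul,
    show (2 : ℂ) * (y + 1 / 2) = 2 * y + 1 by ring]
  simp [mul_comm]

end GeneratingFunction

/-- If `(1 - X) ^ (m + 1) ∑ s_n X ^ n` is a polynomial `P` of degree at most `m`, then the first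
`q + m + 1` coefficients of `(1 - X) ^ (q + m + 1) ∑ s_n X ^ n` are all its coefficients, and they
sum to `(1 - z) ^ q P(z)` against the powers of `z`. -/
lemma sum_pow_mul_sum_coeff {m q : ℕ} {s : ℕ → ℂ} {P : Polynomial ℂ} (hP : P.natDegree ≤ m)
    (hs : (1 - PowerSeries.X) ^ (m + 1) * PowerSeries.mk s = (P : PowerSeries ℂ)) (z : ℂ) :
    ∑ i ∈ Finset.range (q + m + 1), z ^ i * ∑ k ∈ Finset.range (i + 1),
      ((1 - Polynomial.X : Polynomial ℂ) ^ (q + m + 1)).coeff k * s (i - k) =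
    (1 - z) ^ q * P.eval z := by
  have hdeg : ((1 - Polynomial.X) ^ q * P).natDegree < q + m + 1 := by
    have h1 : (1 - Polynomial.X : Polynomial ℂ).natDegree ≤ 1 := by compute_degree
    have h2 : ((1 - Polynomial.X : Polynomial ℂ) ^ q).natDegree ≤ q := by
      simpa using Polynomial.natDegree_pow_le_of_le q h1
    have := Polynomial.natDegree_mul_le (p := (1 - Polynomial.X : Polynomial ℂ) ^ q) (q := P)
    omega
  have hev : ((1 - Polynomial.X) ^ q * P).eval z = (1 - z) ^ q * P.eval z := by simp
  rw [← hev, Polynomial.eval_eq_sum_range' hdeg]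
  refine Finset.sum_congr rfl fun i _ => ?_
  rw [mul_comm]
  congr 1
  have h3 : (((1 - Polynomial.X) ^ q * P : Polynomial ℂ) : PowerSeries ℂ) =
      (((1 - Polynomial.X) ^ (q + m + 1) : Polynomial ℂ) : PowerSeries ℂ) * PowerSeries.mk s := by
    simp only [Polynomial.coe_mul, Polynomial.coe_pow, Polynomial.coe_sub, Polynomial.coe_one,
      Polynomial.coe_X]
    rw [← hs]; ring
  rw [← Polynomial.coeff_coe ((1 - Polynomial.X) ^ q * P), h3, PowerSeries.coeff_mul,
    Finset.Nat.sum_antidiagonal_eq_sum_range_succ_mk]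
  simp only [Polynomial.coeff_coe, PowerSeries.coeff_mk]

lemma scaledKernel_zero {p q m : ℕ} {a : Polynomial ℝ} (hp : a.natDegree = p)
    (hpq : p = q + m + 1) {G : ℝ → ℂ} (hG : G 0 = 1 / (m.factorial : ℂ)) (z : ℂ) (x : ℝ)
    {P : Polynomial ℂ} (hP : P.natDegree ≤ m)
    (hs : (1 - PowerSeries.X) ^ (m + 1) * PowerSeries.mk (fun n : ℕ => ((x : ℂ) + n) ^ m) =
      (P : PowerSeries ℂ)) :
    scaledKernel p a m G z 0 x = (1 - z) ^ q * P.eval z / (m.factorial : ℂ) := by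
  rw [← sum_pow_mul_sum_coeff (s := fun n : ℕ => ((x : ℂ) + n) ^ m) hP hs, scaledKernel,
    filterPoly_zero hp, hpq, Finset.sum_div]
  refine Finset.sum_congr rfl fun i _ => ?_
  rw [mul_div_assoc, Finset.sum_div]
  congr 1
  refine Finset.sum_congr rfl fun k _ => ?_
  rw [zero_mul, hG]
  ring

/-! ### The three limiting constants -/

lemma integral_quartic (k₀ k₁ k₂ k₃ k₄ : ℝ) :
    ∫ x in (0 : ℝ)..1, (k₀ + k₁ * x + k₂ * x ^ 2 + k₃ * x ^ 3 + k₄ * x ^ 4) =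
      k₀ + k₁ / 2 + k₂ / 3 + k₃ / 4 + k₄ / 5 := by
  have h : ∀ x ∈ Set.uIcc (0 : ℝ) 1, HasDerivAt
      (fun x => k₀ * x + k₁ / 2 * x ^ 2 + k₂ / 3 * x ^ 3 + k₃ / 4 * x ^ 4 + k₄ / 5 * x ^ 5)
      (k₀ + k₁ * x + k₂ * x ^ 2 + k₃ * x ^ 3 + k₄ * x ^ 4) x := by
    intro x _
    have := (((((hasDerivAt_id x).const_mul k₀).add ((hasDerivAt_pow 2 x).const_mul (k₁ / 2))).add
      ((hasDerivAt_pow 3 x).const_mul (k₂ / 3))).add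
      ((hasDerivAt_pow 4 x).const_mul (k₃ / 4))).add ((hasDerivAt_pow 5 x).const_mul (k₄ / 5))
    refine this.congr_deriv ?_
    norm_num
    ring
  rw [intervalIntegral.integral_eq_sub_of_hasDerivAt h
    (Continuous.intervalIntegrable (by fun_prop) _ _)]
  ring

lemma exp_neg_I_mul (w : ℝ) : Complex.exp (-(Complex.I * (w : ℂ))) =
    ⟨Real.cos w, -Real.sin w⟩ := by
  have : -(Complex.I * (w : ℂ)) = ((-w : ℝ) : ℂ) * Complex.I := by push_cast; ring
  rw [this]
  apply Complex.ext
  · rw [Complex.exp_ofReal_mul_I_re, Real.cos_neg]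
  · rw [Complex.exp_ofReal_mul_I_im, Real.sin_neg]

lemma norm_one_sub_exp_sq (w : ℝ) :
    ‖1 - Complex.exp (-(Complex.I * (w : ℂ)))‖ ^ 2 = 2 * (1 - Real.cos w) := by
  rw [exp_neg_I_mul, Complex.sq_norm, Complex.normSq_apply]
  simp
  nlinarith [Real.sin_sq_add_cos_sq w]

lemma integral_norm_sq_linear (w : ℝ) :
    ∫ x in (0 : ℝ)..1, ‖(x : ℂ) * (1 - Complex.exp (-(Complex.I * (w : ℂ)))) +
      Complex.exp (-(Complex.I * (w : ℂ)))‖ ^ 2 = 2 / 3 + Real.cos w / 3 := by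
  have h : ∀ x : ℝ, ‖(x : ℂ) * (1 - Complex.exp (-(Complex.I * (w : ℂ)))) +
      Complex.exp (-(Complex.I * (w : ℂ)))‖ ^ 2 = 1 + 2 * (Real.cos w - 1) * x +
        2 * (1 - Real.cos w) * x ^ 2 + 0 * x ^ 3 + 0 * x ^ 4 := by
    intro x
    rw [exp_neg_I_mul, Complex.sq_norm, Complex.normSq_apply]
    simp
    linear_combination (x - 1) ^ 2 * Real.sin_sq_add_cos_sq w
  simp only [h, integral_quartic]
  ring

lemma integral_norm_sq_quadratic (w : ℝ) :
    ∫ x in (0 : ℝ)..1, ‖(x : ℂ) ^ 2 * (1 - Complex.exp (-(Complex.I * (w : ℂ)))) ^ 2 +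
      Complex.exp (-(Complex.I * (w : ℂ))) * ((2 * (x : ℂ) + 1) *
        (1 - Complex.exp (-(Complex.I * (w : ℂ)))) + 2 * Complex.exp (-(Complex.I * (w : ℂ))))‖ ^ 2 =
      4 * (11 / 20 + 13 * Real.cos w / 30 + Real.cos (2 * w) / 60) := by
  have h : ∀ x : ℝ, ‖(x : ℂ) ^ 2 * (1 - Complex.exp (-(Complex.I * (w : ℂ)))) ^ 2 +
      Complex.exp (-(Complex.I * (w : ℂ))) * ((2 * (x : ℂ) + 1) *
        (1 - Complex.exp (-(Complex.I * (w : ℂ)))) + 2 * Complex.exp (-(Complex.I * (w : ℂ))))‖ ^ 2 =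
      (2 + 2 * Real.cos w) + 0 * x + 4 * (1 - Real.cos w) ^ 2 * x ^ 2 +
        -8 * (1 - Real.cos w) ^ 2 * x ^ 3 + 4 * (1 - Real.cos w) ^ 2 * x ^ 4 := by
    intro x
    have hs : Real.sin w ^ 2 = 1 - Real.cos w ^ 2 := by linarith [Real.sin_sq_add_cos_sq w]
    have hs4 : Real.sin w ^ 4 = (1 - Real.cos w ^ 2) ^ 2 := by rw [← hs]; ring
    rw [exp_neg_I_mul, Complex.sq_norm, Complex.normSq_apply]
    simp [pow_two]
    ring_nf
    rw [hs4, hs]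
    ring
  simp only [h, integral_quartic]
  rw [Real.cos_two_mul]
  ring

/-! ### Asymptotics of the spectral density -/

section Limit

variable {Ω : Type*} [MeasurableSpace Ω] {μ : Measure Ω} [IsProbabilityMeasure μ] {p q : ℕ}
  {a b : Polynomial ℝ} {σ : ℝ} {L Y : ℝ → Ω → ℝ}

lemma fMA_eq (hab : IsAdmissible p q a b) (hL : IsSecondOrderLevy μ L σ)
    (hY : IsCARMA μ p a b L Y) {Δ : ℝ} (hΔ : 0 < Δ) (w : ℝ) :
    fMA μ a Y Δ w = 1 / (2 * Real.pi) * (σ ^ 2 * ∫ r in (0 : ℝ)..Δ, ‖∑ i ∈ Finset.range p,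
      Complex.exp (-(Complex.I * (w : ℂ))) ^ i * sampleKernel p a b Δ i r‖ ^ 2) := by
  obtain ⟨X, hX, hYX⟩ := hY.solution
  exact (isMovingSum_filteredSample hL hX hab.a_monic hab.a_degree hYX hΔ).spectralDensity_eq
    (continuous_sampleKernel p a b Δ) (fun _ _ => rfl) w

/-- The asymptotics in terms of the polynomials `P x = (1 - X) ^ (m + 1) ∑_n (x + n) ^ m X ^ n`,
where `m = p - q - 1`. -/
lemma simZero_fMA (hab : IsAdmissible p q a b) (hσ : 0 < σ) (hL : IsSecondOrderLevy μ L σ)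
    (hY : IsCARMA μ p a b L Y) {m : ℕ} (hpq : p = q + m + 1) {w c : ℝ}
    (hw : 1 - Real.cos w ≠ 0 ∨ q = 0)
    {P : ℝ → Polynomial ℂ} (hP : ∀ x, (P x).natDegree ≤ m)
    (hs : ∀ x : ℝ, (1 - PowerSeries.X) ^ (m + 1) *
      PowerSeries.mk (fun n : ℕ => ((x : ℂ) + n) ^ m) = (P x : PowerSeries ℂ))
    (hc : ∫ x in (0 : ℝ)..1, ‖(P x).eval (Complex.exp (-(Complex.I * (w : ℂ))))‖ ^ 2 =
      (m.factorial : ℝ) ^ 2 * c) (hc0 : c ≠ 0) :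
    SimZero (fun Δ => fMA μ a Y Δ w) (fun Δ => σ ^ 2 * Δ ^ (2 * m + 1) / (2 * Real.pi) *
      (c * (2 ^ q * (1 - Real.cos w) ^ q))) := by
  obtain ⟨G, hGc, hG0, hG⟩ := exists_eq_pow_mul m (impulse p a b) (hasDerivAt_impulse p a b)
    (fun k hk => by rw [impulse_zero hab (by omega), if_neg (by omega)])
  rw [impulse_zero hab (by omega), if_pos (by omega)] at hG0
  have hm : (m.factorial : ℝ) ≠ 0 := by exact_mod_cast m.factorial_ne_zero
  refine simZero_of_integral_eq hGc hG (pow_ne_zero 2 hσ.ne')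
    (fun Δ hΔ => fMA_eq hab hL hY hΔ w) ?_ ?_
  · have e : ∀ x : ℝ, ‖scaledKernel p a m G (Complex.exp (-(Complex.I * (w : ℂ)))) 0 x‖ ^ 2 =
        (2 ^ q * (1 - Real.cos w) ^ q) / (m.factorial : ℝ) ^ 2 *
          ‖(P x).eval (Complex.exp (-(Complex.I * (w : ℂ))))‖ ^ 2 := by
      intro x
      rw [scaledKernel_zero hab.a_degree hpq hG0 _ x (hP x) (hs x), norm_div, norm_mul, norm_pow,
        div_pow, mul_pow, ← pow_mul, mul_comm q 2, pow_mul, norm_one_sub_exp_sq, mul_pow,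
        Complex.norm_natCast]
      ring
    simp only [e]
    rw [intervalIntegral.integral_const_mul, hc]
    field_simp
  · refine mul_ne_zero hc0 (mul_ne_zero (by positivity) ?_)
    rcases hw with hw | rfl
    · exact pow_ne_zero q hw
    · simp

end Limit

end CARMA

theorem corollary3p2 {Ω : Type*} [MeasurableSpace Ω] (μ : Measure Ω) [IsProbabilityMeasure μ]
    (p q : ℕ) (a b : Polynomial ℝ) (hab : CARMA.IsAdmissible p q a b)
    (σ : ℝ) (hσ : 0 < σ) (L Y : ℝ → Ω → ℝ)
    (hL : CARMA.IsSecondOrderLevy μ L σ) (hY : CARMA.IsCARMA μ p a b L Y) :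
    -- `f_MA` is well defined and is the spectral density of the filtered sampled sequence
    (∀ Δ : ℝ, 0 < Δ →
      Summable (CARMA.autocov μ (CARMA.filteredSample a Y Δ)) ∧
      CARMA.IsSpectralDensity μ (CARMA.filteredSample a Y Δ) (CARMA.fMA μ a Y Δ)) ∧
    -- the asymptotics; for `w = 0` and `q ≥ 1` the right-hand sides vanish identically
    ∀ w ∈ Set.Icc (-Real.pi) Real.pi, (w ≠ 0 ∨ q = 0) →
      (p - q = 1 →
        CARMA.SimZero (fun Δ => CARMA.fMA μ a Y Δ w)
          (fun Δ => σ ^ 2 * Δ / (2 * Real.pi) * (2 ^ q * (1 - Real.cos w) ^ q))) ∧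
      (p - q = 2 →
        CARMA.SimZero (fun Δ => CARMA.fMA μ a Y Δ w)
          (fun Δ => σ ^ 2 * Δ ^ 3 / (2 * Real.pi) * (2 / 3 + Real.cos w / 3) *
            (2 ^ q * (1 - Real.cos w) ^ q))) ∧
      (p - q = 3 →
        CARMA.SimZero (fun Δ => CARMA.fMA μ a Y Δ w)
          (fun Δ => σ ^ 2 * Δ ^ 5 / (2 * Real.pi) *
            (11 / 20 + 13 * Real.cos w / 30 + Real.cos (2 * w) / 60) *
            (2 ^ q * (1 - Real.cos w) ^ q))) := by
  refine ⟨fun Δ hΔ => ?_, fun w hw hw0 => ?_⟩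
  · obtain ⟨X, hX, hYX⟩ := hY.solution
    have h := CARMA.isMovingSum_filteredSample hL hX hab.a_monic hab.a_degree hYX hΔ
    exact ⟨h.summable_autocov, h.isSpectralDensity (CARMA.continuous_sampleKernel p a b Δ)
      (fun _ _ => rfl) (sq_nonneg σ) hΔ.le⟩
  have hcos : 1 - Real.cos w ≠ 0 ∨ q = 0 := by
    refine hw0.imp_left fun h0 h1 => h0 ?_
    have hpi := Real.pi_pos
    exact (Real.cos_eq_one_iff_of_lt_of_lt (by linarith [hw.1]) (by linarith [hw.2])).1
      (sub_eq_zero.1 h1).symm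
  have hc1 := Real.neg_one_le_cos w
  refine ⟨fun hd => ?_, fun hd => ?_, fun hd => ?_⟩
  · have := CARMA.simZero_fMA hab hσ hL hY (m := 0) (w := w) (c := 1) (by omega) hcos
      (P := fun _ => 1) (fun x => by simp) (fun x => by
        simpa using CARMA.one_sub_X_mul_mk_one) (by simp) one_ne_zero
    simpa using this
  · have := CARMA.simZero_fMA hab hσ hL hY (m := 1) (w := w) (c := 2 / 3 + Real.cos w / 3)
      (by omega) hcos
      (P := fun x => Polynomial.C (x : ℂ) * (1 - Polynomial.X) + Polynomial.X)
      (fun x => by compute_degree)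
      (fun x => by simpa using CARMA.one_sub_X_sq_mul_mk (x : ℂ))
      (by simpa using CARMA.integral_norm_sq_linear w) (by linarith)
    simpa only [mul_assoc] using this
  · have hpos : (0 : ℝ) < 11 / 20 + 13 * Real.cos w / 30 + Real.cos (2 * w) / 60 := by
      rw [Real.cos_two_mul]
      nlinarith [sq_nonneg (Real.cos w + 1)]
    have := CARMA.simZero_fMA hab hσ hL hY (m := 2) (w := w)
      (c := 11 / 20 + 13 * Real.cos w / 30 + Real.cos (2 * w) / 60) (by omega) hcos
      (P := fun x => Polynomial.C ((x : ℂ) ^ 2) * (1 - Polynomial.X) ^ 2 + Polynomial.X *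
        (Polynomial.C (2 * (x : ℂ) + 1) * (1 - Polynomial.X) + Polynomial.C 2 * Polynomial.X))
      (fun x => by compute_degree)
      (fun x => by
        rw [CARMA.one_sub_X_cube_mul_mk]
        simp only [Polynomial.coe_add, Polynomial.coe_mul, Polynomial.coe_pow, Polynomial.coe_sub,
          Polynomial.coe_one, Polynomial.coe_X, Polynomial.coe_C])
      (by
        have := CARMA.integral_norm_sq_quadratic w
        norm_num at this ⊢
        exact this) hpos.ne'
    simpa only [mul_assoc] using this
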